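/- **Cut admissibility for $\mathsf{RTC}^\omega_G$.** *Formulas.* Let $\sigma$ be a first-order signature with equality, and fix a countably infinite set of variables. Formulas are $$\varphi,\psi ::= s=t \mid P(t_1,\dots,t_n)\mid \neg\varphi\mid\varphi\wedge\psi\mid\varphi\vee\psi\mid\varphi\to\psi\mid\forall x.\varphi\mid\exists x.\varphi\mid (RTC_{x,y}\,\varphi)(s,t),$$ where $RTC_{x,y}$ binds $x,y$ in $\varphi$ (not in $s,t$), and formulas are identified up to renaming of bound variables. A sequent $\Gamma\Rightarrow\Delta$ consists of two finite sets of formulas; commas denote union. *Rules.* The system $\mathsf{RTC}^\omega_G$ has the following rules (premises / conclusion). - Axiom: $\varphi\Rightarrow\varphi$. Weakening: $\Gamma\Rightarrow\Delta\ /\ \Gamma,\varphi\Rightarrow\Delta$ and $\Gamma\Rightarrow\Delta\ /\ \Gamma\Rightarrow\Delta,\varphi$. - The propositional rules: $\Gamma,\varphi\Rightarrow\Delta$ and $\Gamma,\psi\Rightarrow\Delta\ /\ \Gamma,\varphi\vee\psi\Rightarrow\Delta$; $\ \Gamma\Rightarrow\varphi,\psi,\Delta\ /\ \Gamma\Rightarrow\varphi\vee\psi,\Delta$;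 $\ \Gamma,\varphi,\psi\Rightarrow\Delta\ /\ \Gamma,\varphi\wedge\psi\Rightarrow\Delta$; $\ \Gamma\Rightarrow\varphi,\Delta$ and $\Gamma\Rightarrow\psi,\Delta\ /\ \Gamma\Rightarrow\varphi\wedge\psi,\Delta$; $\ \Gamma\Rightarrow\varphi,\Delta$ and $\Gamma,\psi\Rightarrow\Delta\ /\ \Gamma,\varphi\to\psi\Rightarrow\Delta$; $\ \Gamma,\varphi\Rightarrow\psi,\Delta\ /\ \Gamma\Rightarrow\varphi\to\psi,\Delta$; $\ \Gamma\Rightarrow\varphi,\Delta\ /\ \Gamma,\neg\varphi\Rightarrow\Delta$; $\ \Gamma,\varphi\Rightarrow\Delta\ /\ \Gamma\Rightarrow\neg\varphi,\Delta$. - The quantifier rules: $\Gamma,\varphi\Rightarrow\Delta\ /\ \Gamma,\exists x.\varphi\Rightarrow\Delta$ and $\Gamma\Rightarrow\varphi,\Delta\ /\ \Gamma\Rightarrow\forall x.\varphi,\Delta$, both for $x$ not free in $\Gamma,\Delta$; $\ \Gamma,\varphi\{t/x\}\Rightarrow\Delta\ /\ \Gamma,\forall x.\varphi\Rightarrow\Delta$;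 $\ \Gamma\Rightarrow\varphi\{t/x\},\Delta\ /\ \Gamma\Rightarrow\exists x.\varphi,\Delta$. - Equality: $\Gamma\Rightarrow\varphi\{s/x\},\Delta\ /\ \Gamma,s=t\Rightarrow\varphi\{t/x\},\Delta$; $\ \Gamma\Rightarrow\varphi\{t/x\},\Delta\ /\ \Gamma,s=t\Rightarrow\varphi\{s/x\},\Delta$; and $\ \Rightarrow t=t$ without premises. - (Subst): $\Gamma\Rightarrow\Delta\ /\ \Gamma\theta\Rightarrow\Delta\theta$ for a substitution $\theta$ of terms for variables. - (Cut): $\Gamma\Rightarrow\varphi,\Delta$ and $\Sigma,\varphi\Rightarrow\Pi\ /\ \Gamma,\Sigma\Rightarrow\Delta,\Pi$. - $\Gamma\Rightarrow\Delta,(RTC_{x,y}\varphi)(s,s)$ without premises; $\ \Gamma\Rightarrow\Delta,(RTC_{x,y}\varphi)(s,r)$ and $\Gamma\Rightarrow\Delta,\varphi\{r/x,t/y\}\ /\ \Gamma\Rightarrow\Delta,(RTC_{x,y}\varphi)(s,t)$. - (Unfold): $\Gamma,s=t\Rightarrow\Delta$ and $\Gamma,(RTC_{x,y}\varphi)(s,z),\varphi\{z/x,t/y\}\Rightarrow\Delta\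 /\ \Gamma,(RTC_{x,y}\varphi)(s,t)\Rightarrow\Delta$, where the variable $z$ is not free in $\Gamma$, $\Delta$ or $(RTC_{x,y}\varphi)(s,t)$. The formula $(RTC_{x,y}\varphi)(s,z)$ of the right premise is the immediate ancestor of the principal formula $(RTC_{x,y}\varphi)(s,t)$. *Proofs.* A pre-proof is a possibly infinite derivation tree built with these rules. A trace pair for the conclusion and a premise of a rule instance is a pair $(\tau,\tau')$ of $RTC$ formulas, $\tau$ in the left-hand side of the conclusion and $\tau'$ in that of the premise, such that $\tau=\tau'\theta$ if the rule is (Subst) with substitution $\theta$, and otherwise $\tau=\tau'$, or (the *progressing* case) the rule is (Unfold), the premise is the right one, $\tau$ is the principal formula and $\tau'$ its immediate ancestor. A pre-proof is a *proof* if for every infinite path from the root there is an infinite sequence of $RTC$ formulas $\tau_0,\tau_1,\dots$ such that, from some point of the path on, consecutive $\tau_i,\tau_{i+1}$ form trace pairs along consecutive steps of the path, infinitely many of them progressing. A sequent is provable (cut-free provable) if it is the root of a proof (of a proof in which (Cut) is not used). **Corollary.** Cut is admissible in $\mathsf{RTC}^\omega_G$: every provable sequent is cut-free provable. In particular, if $\Gamma\Rightarrow\varphi,\Delta$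 and $\Sigma,\varphi\Rightarrow\Pi$ are cut-free provable, then so is $\Gamma,\Sigma\Rightarrow\Delta,\Pi$. -/

import Mathlib

universe u v

namespace RTC

open FirstOrder.Language

/-- Formulas of transitive closure logic over the first-order signature `L`, up to renaming of
bound variables: de Bruijn style, the variables being the natural numbers.  In `all φ` and `ex φ`
the variable `0` of `φ` is bound and the variable `k + 1` of `φ` is the variable `k` outside.
In `rtc φ s t`, which is the formula `(RTC_{x,y} φ)(s,t)`, the variables `0` (this is `x`) and `1`
(this is `y`) of `φ` are bound, and the variable `k + 2` of `φ` is the variable `k` outside;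
nothing is bound in `s` and `t`. -/
inductive Fml (L : FirstOrder.Language.{u, v}) : Type (max u v) where
  | eq (s t : L.Term ℕ) : Fml L
  | rel {n : ℕ} (P : L.Relations n) (ts : Fin n → L.Term ℕ) : Fml L
  | neg (φ : Fml L) : Fml L
  | and (φ ψ : Fml L) : Fml L
  | or (φ ψ : Fml L) : Fml L
  | imp (φ ψ : Fml L) : Fml L
  | all (φ : Fml L) : Fml L
  | ex (φ : Fml L) : Fml L
  | rtc (φ : Fml L) (s t : L.Term ℕ) : Fml L

noncomputable instance (L : FirstOrder.Language.{u, v}) : DecidableEq (Fml L) := Classical.decEq _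

variable {L : FirstOrder.Language.{u, v}}

/-- The substitution that acts under one binder as `σ` acts outside of it. -/
def up (σ : ℕ → L.Term ℕ) : ℕ → L.Term ℕ
  | 0 => Term.var 0
  | k + 1 => (σ k).relabel Nat.succ

/-- Simultaneous capture-avoiding substitution of `σ k` for every free variable `k`. -/
def Fml.subst : Fml L → (ℕ → L.Term ℕ) → Fml L
  | .eq s t, σ => .eq (s.subst σ) (t.subst σ)
  | .rel P ts, σ => .rel P fun i => (ts i).subst σ
  | .neg φ, σ => .neg (φ.subst σ)
  | .and φ ψ, σ => .and (φ.subst σ) (ψ.subst σ)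
  | .or φ ψ, σ => .or (φ.subst σ) (ψ.subst σ)
  | .imp φ ψ, σ => .imp (φ.subst σ) (ψ.subst σ)
  | .all φ, σ => .all (φ.subst (up σ))
  | .ex φ, σ => .ex (φ.subst (up σ))
  | .rtc φ s t, σ => .rtc (φ.subst (up (up σ))) (s.subst σ) (t.subst σ)

/-- `φ{t/x}`, where `x` is the variable `0` of `φ` (the one bound in `all φ` and `ex φ`). -/
def Fml.inst (φ : Fml L) (t : L.Term ℕ) : Fml L :=
  φ.subst fun
    | 0 => t
    | k + 1 => Term.var k

/-- `φ{r/x, t/y}`, where `x`, `y` are the variables `0`, `1` of `φ` (those bound in `rtc φ _ _`). -/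
def Fml.inst₂ (φ : Fml L) (r t : L.Term ℕ) : Fml L :=
  φ.subst fun
    | 0 => r
    | 1 => t
    | k + 2 => Term.var k

/-- The variable `x` occurs free in the formula. -/
def Fml.IsFree : ℕ → Fml L → Prop
  | x, .eq s t => x ∈ s.varFinset ∨ x ∈ t.varFinset
  | x, .rel _ ts => ∃ i, x ∈ (ts i).varFinset
  | x, .neg φ => φ.IsFree x
  | x, .and φ ψ => φ.IsFree x ∨ ψ.IsFree x
  | x, .or φ ψ => φ.IsFree x ∨ ψ.IsFree x
  | x, .imp φ ψ => φ.IsFree x ∨ ψ.IsFree x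
  | x, .all φ => φ.IsFree (x + 1)
  | x, .ex φ => φ.IsFree (x + 1)
  | x, .rtc φ s t => φ.IsFree (x + 2) ∨ x ∈ s.varFinset ∨ x ∈ t.varFinset

/-- The formula is an `RTC` formula, i.e. of the form `(RTC_{x,y} φ)(s,t)`. -/
def Fml.IsRTC (τ : Fml L) : Prop := ∃ φ s t, τ = .rtc φ s t

/-- The variable `x` occurs free in no formula of the set. -/
def Fresh (x : ℕ) (Γ : Finset (Fml L)) : Prop := ∀ φ ∈ Γ, ¬ φ.IsFree x

/-- Sequents `Γ ⇒ Δ`: pairs of finite sets of formulas. -/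
@[ext] structure Sequent (L : FirstOrder.Language.{u, v}) : Type (max u v) where
  ante : Finset (Fml L)
  succ : Finset (Fml L)

/-- Instances of the inference rules, given by the values of the schematic letters of the rule. -/
inductive Rule (L : FirstOrder.Language.{u, v}) : Type (max u v) where
  | ax (φ : Fml L)
  | weakL (Γ Δ : Finset (Fml L)) (φ : Fml L)
  | weakR (Γ Δ : Finset (Fml L)) (φ : Fml L)
  | orL (Γ Δ : Finset (Fml L)) (φ ψ : Fml L)
  | andL (Γ Δ : Finset (Fml L)) (φ ψ : Fml L)
  | impL (Γ Δ : Finset (Fml L)) (φ ψ : Fml L)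
  | orR (Γ Δ : Finset (Fml L)) (φ ψ : Fml L)
  | andR (Γ Δ : Finset (Fml L)) (φ ψ : Fml L)
  | impR (Γ Δ : Finset (Fml L)) (φ ψ : Fml L)
  | negL (Γ Δ : Finset (Fml L)) (φ : Fml L)
  | negR (Γ Δ : Finset (Fml L)) (φ : Fml L)
  | exL (Γ Δ : Finset (Fml L)) (φ : Fml L) (x : ℕ)
  | allL (Γ Δ : Finset (Fml L)) (φ : Fml L) (t : L.Term ℕ)
  | exR (Γ Δ : Finset (Fml L)) (φ : Fml L) (t : L.Term ℕ)
  | allR (Γ Δ : Finset (Fml L)) (φ : Fml L) (x : ℕ)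
  | eqL₁ (Γ Δ : Finset (Fml L)) (φ : Fml L) (s t : L.Term ℕ)
  | eqL₂ (Γ Δ : Finset (Fml L)) (φ : Fml L) (s t : L.Term ℕ)
  | eqR (t : L.Term ℕ)
  | cut (Γ Δ Γ' Δ' : Finset (Fml L)) (φ : Fml L)
  | subst (Γ Δ : Finset (Fml L)) (θ : ℕ → L.Term ℕ)
  | rtcRefl (Γ Δ : Finset (Fml L)) (φ : Fml L) (s : L.Term ℕ)
  | rtcTrans (Γ Δ : Finset (Fml L)) (φ : Fml L) (s r t : L.Term ℕ)
  | rtcUnfold (Γ Δ : Finset (Fml L)) (φ : Fml L) (s t : L.Term ℕ) (z : ℕ)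

namespace Rule

/-- The list of premises and the conclusion of a rule instance. -/
noncomputable def shape : Rule L → List (Sequent L) × Sequent L
  | ax φ => ([], ⟨{φ}, {φ}⟩)
  | weakL Γ Δ φ => ([⟨Γ, Δ⟩], ⟨insert φ Γ, Δ⟩)
  | weakR Γ Δ φ => ([⟨Γ, Δ⟩], ⟨Γ, insert φ Δ⟩)
  | orL Γ Δ φ ψ => ([⟨insert φ Γ, Δ⟩, ⟨insert ψ Γ, Δ⟩], ⟨insert (.or φ ψ) Γ, Δ⟩)
  | andL Γ Δ φ ψ => ([⟨insert φ (insert ψ Γ), Δ⟩], ⟨insert (.and φ ψ) Γ, Δ⟩)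
  | impL Γ Δ φ ψ => ([⟨Γ, insert φ Δ⟩, ⟨insert ψ Γ, Δ⟩], ⟨insert (.imp φ ψ) Γ, Δ⟩)
  | orR Γ Δ φ ψ => ([⟨Γ, insert φ (insert ψ Δ)⟩], ⟨Γ, insert (.or φ ψ) Δ⟩)
  | andR Γ Δ φ ψ => ([⟨Γ, insert φ Δ⟩, ⟨Γ, insert ψ Δ⟩], ⟨Γ, insert (.and φ ψ) Δ⟩)
  | impR Γ Δ φ ψ => ([⟨insert φ Γ, insert ψ Δ⟩], ⟨Γ, insert (.imp φ ψ) Δ⟩)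
  | negL Γ Δ φ => ([⟨Γ, insert φ Δ⟩], ⟨insert (.neg φ) Γ, Δ⟩)
  | negR Γ Δ φ => ([⟨insert φ Γ, Δ⟩], ⟨Γ, insert (.neg φ) Δ⟩)
  | exL Γ Δ φ x => ([⟨insert (φ.inst (Term.var x)) Γ, Δ⟩], ⟨insert (.ex φ) Γ, Δ⟩)
  | allL Γ Δ φ t => ([⟨insert (φ.inst t) Γ, Δ⟩], ⟨insert (.all φ) Γ, Δ⟩)
  | exR Γ Δ φ t => ([⟨Γ, insert (φ.inst t) Δ⟩], ⟨Γ, insert (.ex φ) Δ⟩)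
  | allR Γ Δ φ x => ([⟨Γ, insert (φ.inst (Term.var x)) Δ⟩], ⟨Γ, insert (.all φ) Δ⟩)
  | eqL₁ Γ Δ φ s t => ([⟨Γ, insert (φ.inst s) Δ⟩], ⟨insert (.eq s t) Γ, insert (φ.inst t) Δ⟩)
  | eqL₂ Γ Δ φ s t => ([⟨Γ, insert (φ.inst t) Δ⟩], ⟨insert (.eq s t) Γ, insert (φ.inst s) Δ⟩)
  | eqR t => ([], ⟨∅, {.eq t t}⟩)
  | cut Γ Δ Γ' Δ' φ => ([⟨Γ, insert φ Δ⟩, ⟨insert φ Γ', Δ'⟩], ⟨Γ ∪ Γ', Δ ∪ Δ'⟩)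
  | subst Γ Δ θ => ([⟨Γ, Δ⟩], ⟨Γ.image fun φ => φ.subst θ, Δ.image fun φ => φ.subst θ⟩)
  | rtcRefl Γ Δ φ s => ([], ⟨Γ, insert (.rtc φ s s) Δ⟩)
  | rtcTrans Γ Δ φ s r t =>
      ([⟨Γ, insert (.rtc φ s r) Δ⟩, ⟨Γ, insert (φ.inst₂ r t) Δ⟩], ⟨Γ, insert (.rtc φ s t) Δ⟩)
  | rtcUnfold Γ Δ φ s t z =>
      ([⟨insert (.eq s t) Γ, Δ⟩,
        ⟨insert (.rtc φ s (Term.var z)) (insert (φ.inst₂ (Term.var z) t) Γ), Δ⟩],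
       ⟨insert (.rtc φ s t) Γ, Δ⟩)

/-- The premises of a rule instance, from left to right. -/
noncomputable def prems (r : Rule L) : List (Sequent L) := r.shape.1

/-- The conclusion of a rule instance. -/
noncomputable def concl (r : Rule L) : Sequent L := r.shape.2

/-- The side conditions on eigenvariables.  With named variables, the condition that `x` is not
free in `∃ x. φ` resp. `∀ x. φ` holds by itself. -/
def Side : Rule L → Prop
  | exL Γ Δ φ x => Fresh x Γ ∧ Fresh x Δ ∧ ¬ (Fml.ex φ).IsFree x
  | allR Γ Δ φ x => Fresh x Γ ∧ Fresh x Δ ∧ ¬ (Fml.all φ).IsFree x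
  | rtcUnfold Γ Δ φ s t z => Fresh z Γ ∧ Fresh z Δ ∧ ¬ (Fml.rtc φ s t).IsFree z
  | _ => True

/-- The rule instance is an instance of the cut rule. -/
def IsCut : Rule L → Prop
  | cut .. => True
  | _ => False

/-- `τ` is the principal formula of an unfolding of an `RTC` formula on the left, and `τ'` is its
immediate ancestor in the premise number `i` (premises are counted from `0`, so that `1` is the
right-hand one). -/
def Progressing : Rule L → ℕ → Fml L → Fml L → Prop
  | rtcUnfold _ _ φ s t z, i, τ, τ' => i = 1 ∧ τ = .rtc φ s t ∧ τ' = .rtc φ s (Term.var z)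
  | _, _, _, _ => False

/-- How a formula `τ` of the conclusion may be continued by `τ'` in the premise number `i`. -/
def Continues : Rule L → ℕ → Fml L → Fml L → Prop
  | subst _ _ θ, _, τ, τ' => τ = τ'.subst θ
  | r, i, τ, τ' => r.Progressing i τ τ' ∨ τ = τ'

/-- `(τ, τ')` is a trace pair for the conclusion and the premise number `i` of the rule instance:
both are `RTC` formulas, occurring in the respective left-hand sides, and `τ'` continues `τ`. -/
def TracePair (r : Rule L) (i : ℕ) (τ τ' : Fml L) : Prop :=
  τ.IsRTC ∧ τ'.IsRTC ∧ τ ∈ r.concl.ante ∧ (∃ S, r.prems[i]? = some S ∧ τ' ∈ S.ante) ∧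
    r.Continues i τ τ'

end Rule

/-- Pre-proofs: possibly infinite derivation trees.  The nodes of the tree are the addresses
`a : List ℕ` with `node a ≠ none`; the root is `[]` and `a ++ [i]` is the child number `i` of `a`.
A node is labelled with the rule instance applied there, whose conclusion is the sequent at
the node; its children are in bijection with the premises of the rule instance and carry
these as their sequents. -/
structure PreProof (L : FirstOrder.Language.{u, v}) : Type (max u v) where
  node : List ℕ → Option (Rule L)
  root : ∃ r, node [] = some r
  side : ∀ a r, node a = some r → r.Side
  child : ∀ a r i S, node a = some r → r.prems[i]? = some S →
    ∃ r', node (a ++ [i]) = some r' ∧ r'.concl = S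
  parent : ∀ a i r', node (a ++ [i]) = some r' → ∃ r, node a = some r ∧ i < r.prems.length

namespace PreProof

/-- The sequent at the root is `S`. -/
def Proves (P : PreProof L) (S : Sequent L) : Prop := ∃ r, P.node [] = some r ∧ r.concl = S

/-- The rule instances `r 0, r 1, …` are those along the infinite path of `P` which starts at the
root and turns to the child number `b n` at its `n`-th node. -/
def IsPath (P : PreProof L) (b : ℕ → ℕ) (r : ℕ → Rule L) : Prop :=
  ∀ n, P.node ((List.range n).map b) = some (r n)

/-- The global trace condition: every infinite path is followed, from some point `k` on, by an
infinitely progressing trace. -/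
def IsProof (P : PreProof L) : Prop :=
  ∀ b r, P.IsPath b r → ∃ (k : ℕ) (τ : ℕ → Fml L),
    (∀ i, (r (k + i)).TracePair (b (k + i)) (τ i) (τ (i + 1))) ∧
    (∀ m, ∃ i ≥ m, (r (k + i)).Progressing (b (k + i)) (τ i) (τ (i + 1)))

/-- The cut rule is not used. -/
def CutFree (P : PreProof L) : Prop := ∀ a r, P.node a = some r → ¬ r.IsCut

end PreProof

/-- The sequent has a proof in the infinitary system. -/
def Provable (S : Sequent L) : Prop := ∃ P : PreProof L, P.IsProof ∧ P.Proves S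

/-- The sequent has a proof in the infinitary system without the cut rule. -/
def CutFreeProvable (S : Sequent L) : Prop :=
  ∃ P : PreProof L, P.IsProof ∧ P.CutFree ∧ P.Proves S

end RTC

/-!
Cut is eliminated semantically: the sequents provable with cut are valid in all structures, where
`RTC` is read as reflexive transitive closure, and the valid sequents are provable without cut.

Soundness (`Provable.not_falsifies`). A valuation which falsifies the conclusion of a rule instance
gives one which falsifies some premise (`descends`), so a proof of an invalid sequent has an
infinite path of falsified sequents. The valuations can be chosen so that the least length of a
chain witnessing an `RTC` formula (`Fml.rank`) does not increase along trace pairs and drops at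
progressing ones, because the eigenvariable of an unfolding can denote the last but one element
of a shortest chain. An infinitely progressing trace is therefore impossible.

Completeness (`cutFreeProvable_of_valid`). An exhaustive search decomposes all formulas of a sequent
fairly and keeps the principal formulas; at sequents with a cut-free proof, such a proof is grafted
onto the search tree (`cutFreeProvable_of_search`). If the root has no cut-free proof, the tree has
an infinite path without infinitely progressing trace through sequents which are not cut-free
provable (`exists_branch`). On this path the successive unfoldings of an `RTC` formula on the left
must come to an end, for they would form such a trace otherwise; this is what makes the formula
true. The countermodel (`Branch.truth`) consists of terms modulo provable equality. The equality
rules rewrite only on the right of a sequent, and this is enough: `TermEq` says that replacing one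
term by the other in the succedent does not affect cut-free provability, and it is a congruence.

The signature may be uncountable while the search has only countably many stages, so the terms are
restricted to the countably many function symbols of the sequent at hand.
-/

namespace RTC

open FirstOrder.Language

variable {L : FirstOrder.Language.{u, v}}

/-! ### Semantics -/

section Semantics

universe w

variable {M : Type w}

/-- The valuation under one binder: the bound variable `0` gets the value `m`, the other variables
keep their values from outside. -/
def push (m : M) (v : ℕ → M) : ℕ → M
  | 0 => m
  | k + 1 => v k

/-- `Steps R n a b`: there is an `R`-chain with `n` steps from `a` to `b`. -/
def Steps (R : M → M → Prop) : ℕ → M → M → Prop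
  | 0, a, b => a = b
  | n + 1, a, b => ∃ c, Steps R n a c ∧ R c b

variable [L.Structure M]

/-- Truth of a formula in a structure under a valuation; `RTC` is the reflexive transitive closure,
given by chains of finite length. -/
def Fml.Holds : Fml L → (ℕ → M) → Prop
  | .eq s t, v => s.realize v = t.realize v
  | .rel P ts, v => FirstOrder.Language.Structure.RelMap P fun i => (ts i).realize v
  | .neg φ, v => ¬ φ.Holds v
  | .and φ ψ, v => φ.Holds v ∧ ψ.Holds v
  | .or φ ψ, v => φ.Holds v ∨ ψ.Holds v
  | .imp φ ψ, v => φ.Holds v → ψ.Holds v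
  | .all φ, v => ∀ m, φ.Holds (push m v)
  | .ex φ, v => ∃ m, φ.Holds (push m v)
  | .rtc φ s t, v =>
      ∃ n, Steps (fun a b => φ.Holds (push a (push b v))) n (s.realize v) (t.realize v)

/-- The least length of a chain witnessing a true `RTC` formula (and `0` for other formulas).
This is the quantity that descends along traces. -/
noncomputable def Fml.rank : Fml L → (ℕ → M) → ℕ
  | .rtc φ s t, v =>
      sInf {n | Steps (fun a b => φ.Holds (push a (push b v))) n (s.realize v) (t.realize v)}
  | _, _ => 0

/-- The valuation makes the left-hand side of the sequent true and everything on the right-hand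
side false. -/
def Falsifies (v : ℕ → M) (S : Sequent L) : Prop :=
  (∀ φ ∈ S.ante, φ.Holds v) ∧ ∀ φ ∈ S.succ, ¬ φ.Holds v

theorem realize_up (σ : ℕ → L.Term ℕ) (m : M) (v : ℕ → M) :
    (fun k => (up σ k).realize (push m v)) = push m fun k => (σ k).realize v := by
  funext k
  cases k with
  | zero => rfl
  | succ k => simp only [up, Term.realize_relabel]; rfl

theorem holds_subst (φ : Fml L) (σ : ℕ → L.Term ℕ) (v : ℕ → M) :
    (φ.subst σ).Holds v ↔ φ.Holds fun k => (σ k).realize v := by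
  induction φ generalizing σ v with
  | eq s t => simp [Fml.subst, Fml.Holds, Term.realize_subst]
  | rel P ts => simp [Fml.subst, Fml.Holds, Term.realize_subst]
  | neg φ ih => simp [Fml.subst, Fml.Holds, ih]
  | and φ ψ ih₁ ih₂ => simp [Fml.subst, Fml.Holds, ih₁, ih₂]
  | or φ ψ ih₁ ih₂ => simp [Fml.subst, Fml.Holds, ih₁, ih₂]
  | imp φ ψ ih₁ ih₂ => simp [Fml.subst, Fml.Holds, ih₁, ih₂]
  | all φ ih => simp [Fml.subst, Fml.Holds, ih, realize_up]
  | ex φ ih => simp [Fml.subst, Fml.Holds, ih, realize_up]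
  | rtc φ s t ih => simp [Fml.subst, Fml.Holds, ih, realize_up, Term.realize_subst]

theorem rank_subst (φ : Fml L) (σ : ℕ → L.Term ℕ) (v : ℕ → M) :
    (φ.subst σ).rank v = φ.rank fun k => (σ k).realize v := by
  cases φ <;> simp [Fml.subst, Fml.rank, holds_subst, realize_up, Term.realize_subst]

theorem holds_inst (φ : Fml L) (t : L.Term ℕ) (v : ℕ → M) :
    (φ.inst t).Holds v ↔ φ.Holds (push (t.realize v) v) := by
  rw [Fml.inst, holds_subst]
  refine iff_of_eq (congrArg _ (funext fun k => ?_))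
  cases k <;> rfl

theorem holds_inst₂ (φ : Fml L) (r t : L.Term ℕ) (v : ℕ → M) :
    (φ.inst₂ r t).Holds v ↔ φ.Holds (push (r.realize v) (push (t.realize v) v)) := by
  rw [Fml.inst₂, holds_subst]
  refine iff_of_eq (congrArg _ (funext fun k => ?_))
  rcases k with _ | _ | k <;> rfl

theorem realize_congr (t : L.Term ℕ) {v w : ℕ → M} (h : ∀ x ∈ t.varFinset, v x = w x) :
    t.realize v = t.realize w := by
  induction t with
  | var x => exact h x (by simp [Term.varFinset])
  | func f ts ih =>
    simp only [Term.realize]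
    congr 1
    funext i
    exact ih i fun x hx => h x (by simp only [Term.varFinset, Finset.mem_biUnion]; exact ⟨i, by simp, hx⟩)

theorem holds_congr (φ : Fml L) {v w : ℕ → M} (h : ∀ x, φ.IsFree x → v x = w x) :
    φ.Holds v ↔ φ.Holds w := by
  induction φ generalizing v w with
  | eq s t =>
    simp only [Fml.Holds, realize_congr s fun x hx => h x (Or.inl hx),
      realize_congr t fun x hx => h x (Or.inr hx)]
  | rel P ts =>
    simp only [Fml.Holds]
    rw [funext fun i => realize_congr (ts i) fun x hx => h x ⟨i, hx⟩]
  | neg φ ih => exact not_congr (ih h)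
  | and φ ψ ih₁ ih₂ =>
    exact and_congr (ih₁ fun x hx => h x (Or.inl hx)) (ih₂ fun x hx => h x (Or.inr hx))
  | or φ ψ ih₁ ih₂ =>
    exact or_congr (ih₁ fun x hx => h x (Or.inl hx)) (ih₂ fun x hx => h x (Or.inr hx))
  | imp φ ψ ih₁ ih₂ =>
    exact imp_congr (ih₁ fun x hx => h x (Or.inl hx)) (ih₂ fun x hx => h x (Or.inr hx))
  | all φ ih =>
    refine forall_congr' fun m => ih fun x hx => ?_
    cases x with
    | zero => rfl
    | succ x => exact h x hx
  | ex φ ih =>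
    refine exists_congr fun m => ih fun x hx => ?_
    cases x with
    | zero => rfl
    | succ x => exact h x hx
  | rtc φ s t ih =>
    have hR : (fun a b => φ.Holds (push a (push b v))) = fun a b => φ.Holds (push a (push b w)) := by
      funext a b
      refine propext (ih fun x hx => ?_)
      rcases x with _ | _ | x
      · rfl
      · rfl
      · exact h x (Or.inl hx)
    simp only [Fml.Holds, hR, realize_congr s fun x hx => h x (Or.inr (Or.inl hx)),
      realize_congr t fun x hx => h x (Or.inr (Or.inr hx))]

theorem rank_congr (φ : Fml L) {v w : ℕ → M} (h : ∀ x, φ.IsFree x → v x = w x) :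
    φ.rank v = φ.rank w := by
  cases φ with
  | rtc φ s t =>
    have hR : (fun a b => φ.Holds (push a (push b v))) = fun a b => φ.Holds (push a (push b w)) := by
      funext a b
      refine propext (holds_congr φ fun x hx => ?_)
      rcases x with _ | _ | x
      · rfl
      · rfl
      · exact h x (Or.inl hx)
    simp only [Fml.rank, hR, realize_congr s fun x hx => h x (Or.inr (Or.inl hx)),
      realize_congr t fun x hx => h x (Or.inr (Or.inr hx))]
  | _ => rfl

theorem agree_update {p : ℕ → Prop} {x : ℕ} (hx : ¬ p x) (v : ℕ → M) (m : M) (y : ℕ) (hy : p y) :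
    Function.update v x m y = v y :=
  Function.update_of_ne (fun h : y = x => hx (h ▸ hy)) _ _

theorem holds_update {φ : Fml L} {x : ℕ} (hx : ¬ φ.IsFree x) (v : ℕ → M) (m : M) :
    φ.Holds (Function.update v x m) ↔ φ.Holds v :=
  holds_congr φ (agree_update (p := fun y => φ.IsFree y) hx v m)

theorem rank_update {φ : Fml L} {x : ℕ} (hx : ¬ φ.IsFree x) (v : ℕ → M) (m : M) :
    φ.rank (Function.update v x m) = φ.rank v :=
  rank_congr φ (agree_update (p := fun y => φ.IsFree y) hx v m)

theorem holds_inst_update {φ : Fml L} {x : ℕ} (hx : ¬ φ.IsFree (x + 1)) (v : ℕ → M) (m : M) :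
    (φ.inst (Term.var x)).Holds (Function.update v x m) ↔ φ.Holds (push m v) := by
  rw [holds_inst]
  refine holds_congr φ fun y hy => ?_
  cases y with
  | zero => simp [push]
  | succ y => exact Function.update_of_ne (fun h : y = x => hx (h ▸ hy)) _ _

/-! ### Soundness -/

theorem falsifies_update {S : Sequent L} {x : ℕ} (hΓ : Fresh x S.ante) (hΔ : Fresh x S.succ)
    {v : ℕ → M} (h : Falsifies v S) (m : M) : Falsifies (Function.update v x m) S :=
  ⟨fun φ hφ => (holds_update (hΓ φ hφ) v m).2 (h.1 φ hφ),
    fun φ hφ => (holds_update (hΔ φ hφ) v m).not.2 (h.2 φ hφ)⟩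

theorem falsifies_insert_ante {Γ Δ : Finset (Fml L)} {φ : Fml L} {v : ℕ → M} :
    Falsifies v ⟨insert φ Γ, Δ⟩ ↔ φ.Holds v ∧ Falsifies v ⟨Γ, Δ⟩ := by
  simp [Falsifies, and_assoc]

theorem falsifies_insert_succ {Γ Δ : Finset (Fml L)} {φ : Fml L} {v : ℕ → M} :
    Falsifies v ⟨Γ, insert φ Δ⟩ ↔ ¬ φ.Holds v ∧ Falsifies v ⟨Γ, Δ⟩ := by
  simp only [Falsifies, Finset.forall_mem_insert]
  tauto

/-- If the conclusion of a rule instance is false then so is one of its premises, under a valuation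
for which the rank does not increase along trace pairs, and decreases along progressing ones. -/
def Descends (r : Rule L) (v : ℕ → M) : Prop :=
  ∃ (i : ℕ) (S : Sequent L) (w : ℕ → M), r.prems[i]? = some S ∧ Falsifies w S ∧
    ∀ τ τ', r.TracePair i τ τ' →
      τ'.rank w ≤ τ.rank v ∧ (r.Progressing i τ τ' → τ'.rank w < τ.rank v)

theorem Descends.of_same {r : Rule L} {v : ℕ → M} (i : ℕ) {S : Sequent L}
    (hS : r.prems[i]? = some S) (h : Falsifies v S)
    (hc : ∀ τ τ', r.Continues i τ τ' → τ = τ' := by simp [Rule.Continues, Rule.Progressing])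
    (hp : ∀ τ τ', ¬ r.Progressing i τ τ' := by simp [Rule.Progressing]) :
    Descends r v :=
  ⟨i, S, v, hS, h, fun τ τ' ht => ⟨by rw [hc τ τ' ht.2.2.2.2], fun h' => (hp _ _ h').elim⟩⟩

theorem descends_unfold {Γ Δ : Finset (Fml L)} {φ : Fml L} {s t : L.Term ℕ} {z : ℕ}
    (hz : Fresh z Γ ∧ Fresh z Δ ∧ ¬ (Fml.rtc φ s t).IsFree z) {v : ℕ → M}
    (h : Falsifies v ⟨insert (.rtc φ s t) Γ, Δ⟩) :
    Descends (.rtcUnfold Γ Δ φ s t z) v := by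
  obtain ⟨hz₁, hz₂, hz₃⟩ := hz
  have hz₄ : ¬ φ.IsFree (z + 2) ∧ z ∉ s.varFinset ∧ z ∉ t.varFinset := by
    simpa [Fml.IsFree] using hz₃
  obtain ⟨h₁, h₂⟩ := falsifies_insert_ante.1 h
  have hmin := Nat.sInf_mem (s := {n | Steps (fun a b => φ.Holds (push a (push b v))) n
    (s.realize v) (t.realize v)}) h₁
  have hrank : (Fml.rtc φ s t).rank v = sInf {n | Steps (fun a b => φ.Holds (push a (push b v))) n
    (s.realize v) (t.realize v)} := rfl
  rw [← hrank] at hmin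
  cases hn : (Fml.rtc φ s t).rank v with
  | zero =>
    rw [hn] at hmin
    refine ⟨0, _, v, rfl, falsifies_insert_ante.2 ⟨hmin, h₂⟩, fun τ τ' ht => ⟨?_, ?_⟩⟩
    · rcases ht.2.2.2.2 with h' | rfl
      · exact absurd h'.1 (by decide)
      · exact le_rfl
    · exact fun h' => absurd h'.1 (by decide)
  | succ n =>
    rw [hn] at hmin
    -- the eigenvariable takes the last but one element of a chain of minimal length as its value
    obtain ⟨c, hc₁, hc₂⟩ := hmin
    have hs : s.realize (Function.update v z c) = s.realize v :=
      realize_congr s (agree_update (p := fun y => y ∈ s.varFinset) hz₄.2.1 v c)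
    have ht : t.realize (Function.update v z c) = t.realize v :=
      realize_congr t (agree_update (p := fun y => y ∈ t.varFinset) hz₄.2.2 v c)
    have hR : ∀ a b, φ.Holds (push a (push b (Function.update v z c))) ↔
        φ.Holds (push a (push b v)) := fun a b => by
      refine holds_congr φ fun y hy => ?_
      rcases y with _ | _ | y
      · rfl
      · rfl
      · exact Function.update_of_ne (fun h : y = z => hz₄.1 (h ▸ hy)) _ _
    have hsteps : Steps (fun a b => φ.Holds (push a (push b (Function.update v z c)))) n
        (s.realize (Function.update v z c))
        ((Term.var z : L.Term ℕ).realize (Function.update v z c)) := by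
      simpa only [hR, hs, Term.realize_var, Function.update_self] using hc₁
    refine ⟨1, _, Function.update v z c, rfl, ?_, fun τ τ' hp => ?_⟩
    · refine falsifies_insert_ante.2 ⟨⟨n, hsteps⟩, falsifies_insert_ante.2 ⟨?_,
        falsifies_update hz₁ hz₂ h₂ c⟩⟩
      rw [holds_inst₂, hR, ht]
      simpa using hc₂
    · have hlt : (Rule.rtcUnfold Γ Δ φ s t z).Progressing 1 τ τ' →
          τ'.rank (Function.update v z c) < τ.rank v := by
        rintro ⟨-, rfl, rfl⟩
        rw [hn]
        exact Nat.lt_succ_of_le (Nat.sInf_le hsteps)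
      refine ⟨?_, hlt⟩
      rcases hp.2.2.2.2 with h' | rfl
      · exact (hlt h').le
      · refine (rank_update ?_ v c).le
        rcases Finset.mem_insert.1 hp.2.2.1 with rfl | hΓ
        · exact hz₃
        · exact hz₁ _ hΓ

theorem Descends.of_update {r : Rule L} {v : ℕ → M} {x : ℕ} {m : M} (i : ℕ) {S : Sequent L}
    (hS : r.prems[i]? = some S) (h : Falsifies (Function.update v x m) S)
    (hx : Fresh x r.concl.ante)
    (hc : ∀ τ τ', r.Continues i τ τ' → τ = τ' := by simp [Rule.Continues, Rule.Progressing])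
    (hp : ∀ τ τ', ¬ r.Progressing i τ τ' := by simp [Rule.Progressing]) : Descends r v := by
  refine ⟨i, S, _, hS, h, fun τ τ' ht => ⟨?_, fun h' => (hp _ _ h').elim⟩⟩
  obtain rfl := hc τ τ' ht.2.2.2.2
  exact (rank_update (hx _ ht.2.2.1) v m).le

theorem descends {r : Rule L} (hr : r.Side) {v : ℕ → M} (h : Falsifies v r.concl) :
    Descends r v := by
  cases r with
  | ax φ => exact (h.2 φ (by simp [Rule.concl, Rule.shape])
      (h.1 φ (by simp [Rule.concl, Rule.shape]))).elim
  | eqR t => exact (h.2 (.eq t t) (by simp [Rule.concl, Rule.shape]) rfl).elim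
  | rtcRefl Γ Δ φ s => exact (h.2 (.rtc φ s s) (by simp [Rule.concl, Rule.shape]) ⟨0, rfl⟩).elim
  | weakL Γ Δ φ =>
    exact .of_same 0 rfl (falsifies_insert_ante.1 h).2
  | weakR Γ Δ φ =>
    exact .of_same 0 rfl (falsifies_insert_succ.1 h).2
  | orL Γ Δ φ ψ =>
    obtain ⟨h₁ | h₁, h₂⟩ := falsifies_insert_ante.1 h
    · exact .of_same 0 rfl (falsifies_insert_ante.2 ⟨h₁, h₂⟩)
    · exact .of_same 1 rfl (falsifies_insert_ante.2 ⟨h₁, h₂⟩)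
  | andL Γ Δ φ ψ =>
    obtain ⟨⟨h₁, h₁'⟩, h₂⟩ := falsifies_insert_ante.1 h
    exact .of_same 0 rfl (falsifies_insert_ante.2 ⟨h₁, falsifies_insert_ante.2 ⟨h₁', h₂⟩⟩)
  | impL Γ Δ φ ψ =>
    obtain ⟨h₁, h₂⟩ := falsifies_insert_ante.1 h
    by_cases hφ : φ.Holds v
    · exact .of_same 1 rfl (falsifies_insert_ante.2 ⟨h₁ hφ, h₂⟩)
    · exact .of_same 0 rfl (falsifies_insert_succ.2 ⟨hφ, h₂⟩)
  | orR Γ Δ φ ψ =>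
    obtain ⟨h₁, h₂⟩ := falsifies_insert_succ.1 h
    obtain ⟨h₁, h₁'⟩ := not_or.1 h₁
    exact .of_same 0 rfl (falsifies_insert_succ.2 ⟨h₁, falsifies_insert_succ.2 ⟨h₁', h₂⟩⟩)
  | andR Γ Δ φ ψ =>
    obtain ⟨h₁, h₂⟩ := falsifies_insert_succ.1 h
    rcases not_and_or.1 h₁ with h₁ | h₁
    · exact .of_same 0 rfl (falsifies_insert_succ.2 ⟨h₁, h₂⟩)
    · exact .of_same 1 rfl (falsifies_insert_succ.2 ⟨h₁, h₂⟩)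
  | impR Γ Δ φ ψ =>
    obtain ⟨h₁, h₂⟩ := falsifies_insert_succ.1 h
    obtain ⟨h₁, h₁'⟩ := Classical.not_imp.1 h₁
    exact .of_same 0 rfl (falsifies_insert_ante.2 ⟨h₁, falsifies_insert_succ.2 ⟨h₁', h₂⟩⟩)
  | negL Γ Δ φ =>
    obtain ⟨h₁, h₂⟩ := falsifies_insert_ante.1 h
    exact .of_same 0 rfl (falsifies_insert_succ.2 ⟨h₁, h₂⟩)
  | negR Γ Δ φ =>
    obtain ⟨h₁, h₂⟩ := falsifies_insert_succ.1 h
    exact .of_same 0 rfl (falsifies_insert_ante.2 ⟨not_not.1 h₁, h₂⟩)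
  | allL Γ Δ φ t =>
    obtain ⟨h₁, h₂⟩ := falsifies_insert_ante.1 h
    exact .of_same 0 rfl (falsifies_insert_ante.2 ⟨(holds_inst _ _ _).2 (h₁ _), h₂⟩)
  | exR Γ Δ φ t =>
    obtain ⟨h₁, h₂⟩ := falsifies_insert_succ.1 h
    exact .of_same 0 rfl
      (falsifies_insert_succ.2 ⟨fun h' => h₁ ⟨_, (holds_inst _ _ _).1 h'⟩, h₂⟩)
  | exL Γ Δ φ x =>
    obtain ⟨hx₁, hx₂, hx₃⟩ := hr
    obtain ⟨⟨m, h₁⟩, h₂⟩ := falsifies_insert_ante.1 h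
    exact .of_update (x := x) (m := m) 0 rfl
      (falsifies_insert_ante.2 ⟨(holds_inst_update hx₃ v m).2 h₁, falsifies_update hx₁ hx₂ h₂ m⟩)
      (Finset.forall_mem_insert _ _ _ |>.2 ⟨hx₃, hx₁⟩)
  | allR Γ Δ φ x =>
    obtain ⟨hx₁, hx₂, hx₃⟩ := hr
    obtain ⟨h₁, h₂⟩ := falsifies_insert_succ.1 h
    obtain ⟨m, h₁⟩ := not_forall.1 h₁
    exact .of_update (x := x) (m := m) 0 rfl
      (falsifies_insert_succ.2 ⟨(holds_inst_update hx₃ v m).not.2 h₁,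
        falsifies_update hx₁ hx₂ h₂ m⟩) hx₁
  | eqL₁ Γ Δ φ s t =>
    obtain ⟨h₁, h₂⟩ := falsifies_insert_ante.1 h
    obtain ⟨h₂, h₃⟩ := falsifies_insert_succ.1 h₂
    refine .of_same 0 rfl (falsifies_insert_succ.2 ⟨?_, h₃⟩)
    rw [holds_inst] at h₂ ⊢
    rwa [show s.realize v = t.realize v from h₁]
  | eqL₂ Γ Δ φ s t =>
    obtain ⟨h₁, h₂⟩ := falsifies_insert_ante.1 h
    obtain ⟨h₂, h₃⟩ := falsifies_insert_succ.1 h₂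
    refine .of_same 0 rfl (falsifies_insert_succ.2 ⟨?_, h₃⟩)
    rw [holds_inst] at h₂ ⊢
    rwa [← show s.realize v = t.realize v from h₁]
  | cut Γ Δ Γ' Δ' φ =>
    have h' : (∀ ψ ∈ Γ ∪ Γ', ψ.Holds v) ∧ ∀ ψ ∈ Δ ∪ Δ', ¬ ψ.Holds v := h
    by_cases hφ : φ.Holds v
    · exact .of_same 1 rfl (falsifies_insert_ante.2 ⟨hφ,
        fun ψ hψ => h'.1 ψ (Finset.mem_union_right _ hψ),
        fun ψ hψ => h'.2 ψ (Finset.mem_union_right _ hψ)⟩)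
    · exact .of_same 0 rfl (falsifies_insert_succ.2 ⟨hφ,
        fun ψ hψ => h'.1 ψ (Finset.mem_union_left _ hψ),
        fun ψ hψ => h'.2 ψ (Finset.mem_union_left _ hψ)⟩)
  | subst Γ Δ θ =>
    refine ⟨0, ⟨Γ, Δ⟩, fun k => (θ k).realize v, rfl,
      ⟨fun φ hφ => (holds_subst _ _ _).1 (h.1 _ (Finset.mem_image_of_mem _ hφ)),
        fun φ hφ => (holds_subst _ _ _).not.1 (h.2 _ (Finset.mem_image_of_mem _ hφ))⟩,
      fun τ τ' ht => ⟨?_, fun h' => h'.elim⟩⟩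
    rw [show τ = τ'.subst θ from ht.2.2.2.2, rank_subst]
  | rtcTrans Γ Δ φ s r t =>
    obtain ⟨h₁, h₂⟩ := falsifies_insert_succ.1 h
    by_cases hφ : (Fml.rtc φ s r).Holds v
    · obtain ⟨n, hn⟩ := hφ
      exact .of_same 1 rfl (falsifies_insert_succ.2
          ⟨fun h' => h₁ ⟨n + 1, _, hn, (holds_inst₂ _ _ _ _).1 h'⟩, h₂⟩)
    · exact .of_same 0 rfl (falsifies_insert_succ.2 ⟨hφ, h₂⟩)
  | rtcUnfold Γ Δ φ s t z => exact descends_unfold hr h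

/-- Provable sequents are valid: a false conclusion would give an infinite path of false sequents,
and the ranks along an infinitely progressing trace on it would descend for ever. -/
theorem Provable.not_falsifies {S : Sequent L} (hS : Provable S) (v : ℕ → M) :
    ¬ Falsifies v S := by
  intro hv
  obtain ⟨P, hP, r₀, hr₀, rfl⟩ := hS
  let X := {p : List ℕ × (ℕ → M) // ∃ r, P.node p.1 = some r ∧ Falsifies p.2 r.concl}
  have step : ∀ p : X, ∃ (i : ℕ) (q : X) (r : Rule L), P.node p.1.1 = some r ∧
      q.1.1 = p.1.1 ++ [i] ∧ ∀ τ τ', r.TracePair i τ τ' →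
        τ'.rank q.1.2 ≤ τ.rank p.1.2 ∧ (r.Progressing i τ τ' → τ'.rank q.1.2 < τ.rank p.1.2) := by
    rintro ⟨⟨a, w⟩, r, hr, hw⟩
    obtain ⟨i, S, w', hS, hw', hd⟩ := descends (P.side a r hr) hw
    obtain ⟨r', hr', rfl⟩ := P.child a r i S hr hS
    exact ⟨i, ⟨(a ++ [i], w'), r', hr', hw'⟩, r, hr, rfl, hd⟩
  choose turn next rule hrule hnext hdesc using step
  let x : ℕ → X := fun n => Nat.rec ⟨([], v), r₀, hr₀, hv⟩ (fun _ p => next p) n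
  have hx : ∀ n, (List.range n).map (fun n => turn (x n)) = (x n).1.1 := by
    intro n
    induction n with
    | zero => rfl
    | succ n ih => rw [List.range_succ, List.map_append, ih]; exact (hnext (x n)).symm
  obtain ⟨k, τ, hτ, hprog⟩ := hP (fun n => turn (x n)) (fun n => rule (x n)) fun n => by
    rw [hx]; exact hrule (x n)
  let ρ : ℕ → ℕ := fun i => (τ i).rank (x (k + i)).1.2
  have hanti : Antitone ρ := antitone_nat_of_succ_le fun i => (hdesc (x (k + i)) _ _ (hτ i)).1
  obtain ⟨m, hm⟩ : ∃ m, ∀ i, ρ m ≤ ρ i := by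
    obtain ⟨m, hm⟩ := Nat.sInf_mem (Set.range_nonempty ρ)
    exact ⟨m, fun i => hm ▸ Nat.sInf_le ⟨i, rfl⟩⟩
  obtain ⟨i, hi, hpi⟩ := hprog m
  have h₁ : ρ (i + 1) < ρ i := (hdesc (x (k + i)) _ _ (hτ i)).2 hpi
  exact absurd (h₁.trans_le (hanti hi)) (not_lt.2 (hm _))

end Semantics

/-! ### Building cut-free proofs -/

/-- The infinite path with turns `b` and rule instances `r` is followed from some point on by an
infinitely progressing trace. -/
def HasTrace (b : ℕ → ℕ) (r : ℕ → Rule L) : Prop :=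
  ∃ (k : ℕ) (τ : ℕ → Fml L),
    (∀ i, (r (k + i)).TracePair (b (k + i)) (τ i) (τ (i + 1))) ∧
    (∀ m, ∃ i ≥ m, (r (k + i)).Progressing (b (k + i)) (τ i) (τ (i + 1)))

theorem HasTrace.of_shift {b : ℕ → ℕ} {r : ℕ → Rule L} (N : ℕ)
    (h : HasTrace (fun n => b (N + n)) fun n => r (N + n)) : HasTrace b r := by
  obtain ⟨k, τ, h₁, h₂⟩ := h
  refine ⟨N + k, τ, ?_, ?_⟩
  · simpa only [← add_assoc] using h₁
  · simpa only [← add_assoc] using h₂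

section Unfold

universe w

variable {X : Type w} (rule : X → Rule L) (next : X → ℕ → X)

/-- The state reached from `x` by the turns in the list; `none` if a turn leads to a premise which
does not exist. -/
noncomputable def run (x : X) (a : List ℕ) : Option X :=
  a.foldl (fun o i => o.bind fun y => if i < (rule y).prems.length then some (next y i) else none)
    (some x)

theorem run_append (x : X) (a : List ℕ) (i : ℕ) :
    run rule next x (a ++ [i]) = (run rule next x a).bind fun y =>
      if i < (rule y).prems.length then some (next y i) else none := by
  simp [run]

/-- The tree unfolding of a transition system in which every state carries a rule instance with
matching premises. -/
theorem cutFreeProvable_of_unfold (hside : ∀ x, (rule x).Side) (hcut : ∀ x, ¬ (rule x).IsCut)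
    (hnext : ∀ x i S, (rule x).prems[i]? = some S → (rule (next x i)).concl = S) (x₀ : X)
    (htrace : ∀ (b : ℕ → ℕ) (x : ℕ → X), x 0 = x₀ →
      (∀ n, b n < (rule (x n)).prems.length ∧ x (n + 1) = next (x n) (b n)) →
      HasTrace b fun n => rule (x n)) :
    CutFreeProvable (rule x₀).concl := by
  let P : PreProof L :=
    { node := fun a => (run rule next x₀ a).map rule
      root := ⟨rule x₀, rfl⟩
      side := fun a r h => by
        obtain ⟨x, -, rfl⟩ := Option.map_eq_some_iff.1 h
        exact hside x
      child := fun a r i S h hS => by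
        obtain ⟨x, hx, rfl⟩ := Option.map_eq_some_iff.1 h
        obtain ⟨hi, -⟩ := List.getElem?_eq_some_iff.1 hS
        exact ⟨rule (next x i), by simp [run_append, hx, hi], hnext x i S hS⟩
      parent := fun a i r' h => by
        obtain ⟨y, hy, -⟩ := Option.map_eq_some_iff.1 h
        rw [run_append] at hy
        obtain ⟨x, hx, hxy⟩ := Option.bind_eq_some_iff.1 hy
        refine ⟨rule x, by simp [hx], ?_⟩
        by_contra hlt
        simp [hlt] at hxy }
  refine ⟨P, fun b r hr => ?_, fun a r h => ?_, rule x₀, rfl, rfl⟩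
  · have hx : ∀ n, ∃ x, run rule next x₀ ((List.range n).map b) = some x ∧ rule x = r n :=
      fun n => Option.map_eq_some_iff.1 (hr n)
    choose x hx hxr using hx
    have h := htrace b x (Option.some.inj (hx 0).symm) fun n => by
      have h := hx (n + 1)
      rw [List.range_succ, List.map_append] at h
      simp only [List.map_cons, List.map_nil, run_append, hx, Option.bind_some] at h
      split_ifs at h with hlt
      exact ⟨hlt, (Option.some.inj h).symm⟩
    rwa [funext hxr] at h
  · obtain ⟨x, -, rfl⟩ := Option.map_eq_some_iff.1 h
    exact hcut x

/-- Unfolding of a transition system, with given cut-free proofs grafted at the states whose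
sequents have one: only paths through cut-free unprovable sequents need a trace. -/
theorem cutFreeProvable_of_search (seq : X → Sequent L)
    (hstep : ∀ x, ¬ CutFreeProvable (seq x) → (rule x).Side ∧ ¬ (rule x).IsCut ∧
      (rule x).concl = seq x ∧ ∀ i S, (rule x).prems[i]? = some S → seq (next x i) = S) (x₀ : X)
    (htrace : ∀ (b : ℕ → ℕ) (x : ℕ → X), x 0 = x₀ → (∀ n, ¬ CutFreeProvable (seq (x n))) →
      (∀ n, b n < (rule (x n)).prems.length ∧ x (n + 1) = next (x n) (b n)) →
      HasTrace b fun n => rule (x n)) :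
    CutFreeProvable (seq x₀) := by
  classical
  let A := {x : X // ¬ CutFreeProvable (seq x)}
  let B := {p : PreProof L × List ℕ // (p.1.IsProof ∧ p.1.CutFree) ∧ ∃ r, p.1.node p.2 = some r}
  have henter : ∀ x, ∃ y : A ⊕ B, (∀ h : ¬ CutFreeProvable (seq x), y = .inl ⟨x, h⟩) ∧
      (CutFreeProvable (seq x) → ∃ p : B, y = .inr p ∧ p.1.2 = [] ∧
        ∀ r, p.1.1.node p.1.2 = some r → r.concl = seq x) := by
    intro x
    by_cases h : CutFreeProvable (seq x)
    · obtain ⟨P, hP, hP', r, hr, hS⟩ := id h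
      refine ⟨.inr ⟨(P, []), ⟨hP, hP'⟩, r, hr⟩, fun h' => (h' h).elim, fun _ => ⟨_, rfl, rfl, ?_⟩⟩
      intro r' hr'
      obtain rfl := Option.some.inj (hr.symm.trans hr')
      exact hS
    · exact ⟨.inl ⟨x, h⟩, fun _ => rfl, fun h' => (h h').elim⟩
  choose enter henter₁ henter₂ using henter
  let rule' : A ⊕ B → Rule L := Sum.elim (fun x => rule x.1) fun p => p.2.2.choose
  have hrule' : ∀ p : B, p.1.1.node p.1.2 = some (rule' (.inr p)) := fun p => p.2.2.choose_spec
  have hconcl : ∀ x, (rule' (enter x)).concl = seq x := by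
    intro x
    by_cases h : CutFreeProvable (seq x)
    · obtain ⟨p, hp, -, hp'⟩ := henter₂ x h
      rw [hp]
      exact hp' _ (hrule' p)
    · rw [henter₁ x h]
      exact (hstep x h).2.2.1
  let next' : A ⊕ B → ℕ → A ⊕ B := fun y i => match y with
    | .inl x => enter (next x.1 i)
    | .inr p => if h : ∃ r, p.1.1.node (p.1.2 ++ [i]) = some r then
        .inr ⟨(p.1.1, p.1.2 ++ [i]), p.2.1, h⟩ else .inr p
  have hnext' : ∀ (p : B) i S, (rule' (.inr p)).prems[i]? = some S → ∃ q : B,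
      next' (.inr p) i = .inr q ∧ q.1.1 = p.1.1 ∧ q.1.2 = p.1.2 ++ [i] ∧
        (rule' (.inr q)).concl = S := by
    intro p i S hS
    obtain ⟨r', hr', hrS⟩ := p.1.1.child _ _ i S (hrule' p) hS
    have h : ∃ r, p.1.1.node (p.1.2 ++ [i]) = some r := ⟨r', hr'⟩
    refine ⟨⟨(p.1.1, p.1.2 ++ [i]), p.2.1, h⟩, dif_pos h, rfl, rfl, ?_⟩
    obtain rfl := Option.some.inj (hr'.symm.trans (hrule' ⟨(p.1.1, p.1.2 ++ [i]), p.2.1, h⟩))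
    exact hrS
  have := cutFreeProvable_of_unfold rule' next' ?_ ?_ ?_ (enter x₀) ?_
  · rwa [hconcl] at this
  · rintro (x | p)
    · exact (hstep x.1 x.2).1
    · exact p.1.1.side _ _ (hrule' p)
  · rintro (x | p)
    · exact (hstep x.1 x.2).2.1
    · exact p.2.1.2 _ _ (hrule' p)
  · rintro (x | p) i S hS
    · rw [← (hstep x.1 x.2).2.2.2 i S hS]
      exact hconcl _
    · obtain ⟨q, hq, -, -, hqS⟩ := hnext' p i S hS
      rw [hq]
      exact hqS
  · intro b y hy₀ hy
    by_cases hN : ∃ N p, y N = .inr p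
    · -- the path enters a grafted proof, at its root
      obtain ⟨p, hp⟩ := Nat.find_spec hN
      have hmin : ∀ n < Nat.find hN, ∃ x, y n = .inl x := fun n hn => by
        rcases hyn : y n with x | q
        · exact ⟨x, rfl⟩
        · exact (Nat.find_min hN hn ⟨q, hyn⟩).elim
      generalize Nat.find hN = N at hp hmin
      have henter : ∃ x, y N = enter x := by
        cases N with
        | zero => exact ⟨x₀, hy₀⟩
        | succ n =>
          obtain ⟨x, hx⟩ := hmin n n.lt_succ_self
          exact ⟨next x.1 (b n), by rw [(hy n).2, hx]⟩
      have hroot : p.1.2 = [] := by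
        obtain ⟨x, hx⟩ := henter
        by_cases h : CutFreeProvable (seq x)
        · obtain ⟨q, hq, hq', -⟩ := henter₂ x h
          obtain rfl := Sum.inr.inj (hp.symm.trans (hx.trans hq))
          exact hq'
        · have := hp.symm.trans (hx.trans (henter₁ x h))
          cases this
      have hq : ∀ n, ∃ q : B, y (N + n) = .inr q ∧ q.1.1 = p.1.1 ∧
          q.1.2 = (List.range n).map fun n => b (N + n) := by
        intro n
        induction n with
        | zero => exact ⟨p, hp, rfl, hroot⟩
        | succ n ih =>
          obtain ⟨q, hq, hq₁, hq₂⟩ := ih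
          obtain ⟨hlt, hs⟩ := hy (N + n)
          rw [hq] at hlt hs
          obtain ⟨q', hq', h₁, h₂, -⟩ := hnext' q _ _ (List.getElem?_eq_getElem hlt)
          refine ⟨q', hs.trans hq', h₁.trans hq₁, ?_⟩
          rw [h₂, hq₂, List.range_succ, List.map_append]
          rfl
      refine HasTrace.of_shift N (p.2.1.1 (fun n => b (N + n)) (fun n => rule' (y (N + n)))
        fun n => ?_)
      obtain ⟨q, hq, hq₁, hq₂⟩ := hq n
      simp only [hq]
      rw [← hq₁, ← hq₂]
      exact hrule' q
    · have hx : ∀ n, ∃ x, y n = .inl x := fun n => by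
        rcases hyn : y n with x | q
        · exact ⟨x, rfl⟩
        · exact (hN ⟨n, q, hyn⟩).elim
      have hinl : ∀ x a, enter x = .inl a → a.1 = x := by
        intro x a h
        by_cases hx : CutFreeProvable (seq x)
        · obtain ⟨q, hq, -⟩ := henter₂ x hx
          cases hq.symm.trans h
        · exact congrArg Subtype.val (Sum.inl.inj (h.symm.trans (henter₁ x hx)))
      choose x hx using hx
      have h := htrace b (fun n => (x n).1) (hinl _ _ (hy₀.symm.trans (hx 0))) (fun n => (x n).2)
        fun n => by
          obtain ⟨hlt, hs⟩ := hy n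
          rw [hx n] at hlt hs
          exact ⟨hlt, hinl _ _ (hs.symm.trans (hx (n + 1)))⟩
      rwa [show (fun n => rule' (y n)) = fun n => rule (x n).1 from
        funext fun n => by rw [hx n]; rfl]

end Unfold

/-- Cut-free provability is closed under the rules other than cut. -/
theorem CutFreeProvable.of_rule (r : Rule L) (hs : r.Side) (hc : ¬ r.IsCut)
    (h : ∀ S ∈ r.prems, CutFreeProvable S) : CutFreeProvable r.concl := by
  refine cutFreeProvable_of_search (X := {S // S = r.concl ∨ S ∈ r.prems}) (fun _ => r)
    (fun _ i => if hi : i < r.prems.length then ⟨r.prems[i], Or.inr (List.getElem_mem hi)⟩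
      else ⟨r.concl, Or.inl rfl⟩) Subtype.val ?_ ⟨r.concl, Or.inl rfl⟩ ?_
  · rintro ⟨S, rfl | hS⟩ hx
    · refine ⟨hs, hc, rfl, fun i S hS => ?_⟩
      obtain ⟨hi, rfl⟩ := List.getElem?_eq_some_iff.1 hS
      simp [hi]
    · exact (hx (h S hS)).elim
  · intro b x _ hx hn
    obtain ⟨hlt, h₁⟩ := hn 0
    refine (hx 1 (h _ ?_)).elim
    rw [h₁, dif_pos hlt]
    exact List.getElem_mem hlt

theorem CutFreeProvable.weaken {Γ Γ' Δ Δ' : Finset (Fml L)} (h : CutFreeProvable ⟨Γ, Δ⟩)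
    (hΓ : Γ ⊆ Γ') (hΔ : Δ ⊆ Δ') : CutFreeProvable ⟨Γ', Δ'⟩ := by
  have h₁ : ∀ Θ : Finset (Fml L), CutFreeProvable ⟨Θ ∪ Γ, Δ⟩ := by
    intro Θ
    induction Θ using Finset.induction with
    | empty => simpa using h
    | insert φ Θ _ ih =>
      rw [Finset.insert_union]
      exact .of_rule (.weakL (Θ ∪ Γ) Δ φ) trivial id (by simpa [Rule.prems, Rule.shape] using ih)
  have h₂ : ∀ Θ : Finset (Fml L), CutFreeProvable ⟨Γ', Θ ∪ Δ⟩ := by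
    intro Θ
    induction Θ using Finset.induction with
    | empty =>
      have := h₁ Γ'
      rw [Finset.union_eq_left.2 hΓ] at this
      simpa using this
    | insert φ Θ _ ih =>
      rw [Finset.insert_union]
      exact .of_rule (.weakR Γ' (Θ ∪ Δ) φ) trivial id (by simpa [Rule.prems, Rule.shape] using ih)
  have := h₂ Δ'
  rwa [Finset.union_eq_left.2 hΔ] at this

theorem CutFreeProvable.of_mem {Γ Δ : Finset (Fml L)} {φ : Fml L} (hΓ : φ ∈ Γ) (hΔ : φ ∈ Δ) :
    CutFreeProvable ⟨Γ, Δ⟩ :=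
  (CutFreeProvable.of_rule (.ax φ) trivial id (by simp [Rule.prems, Rule.shape])).weaken
    (Finset.singleton_subset_iff.2 hΓ) (Finset.singleton_subset_iff.2 hΔ)

/-! ### Substitution -/

theorem up_var : up (fun k => (Term.var k : L.Term ℕ)) = fun k => Term.var k := by
  funext k
  cases k <;> rfl

theorem Fml.subst_var (φ : Fml L) : φ.subst (fun k => Term.var k) = φ := by
  have ht : ∀ t : L.Term ℕ, t.subst (fun k => Term.var k) = t := fun t => by
    induction t with
    | var x => rfl
    | func f ts ih => simp [Term.subst, ih]
  induction φ with
  | eq s t => simp [Fml.subst, ht]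
  | rel P ts => simp [Fml.subst, ht]
  | rtc φ s t ih => simp [Fml.subst, ht, up_var, ih]
  | _ => simp_all [Fml.subst, up_var]

theorem term_subst_subst (t : L.Term ℕ) (σ τ : ℕ → L.Term ℕ) :
    (t.subst σ).subst τ = t.subst fun k => (σ k).subst τ := by
  induction t with
  | var x => rfl
  | func f ts ih => simp [Term.subst, ih]

theorem up_subst_up (σ τ : ℕ → L.Term ℕ) :
    (fun k => (up σ k).subst (up τ)) = up fun k => (σ k).subst τ := by
  funext k
  cases k with
  | zero => rfl
  | succ k =>
    simp only [up]
    induction σ k with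
    | var x => rfl
    | func f ts ih => simp [Term.subst, Term.relabel, ih]

theorem Fml.subst_subst (φ : Fml L) (σ τ : ℕ → L.Term ℕ) :
    (φ.subst σ).subst τ = φ.subst fun k => (σ k).subst τ := by
  induction φ generalizing σ τ with
  | eq s t => simp [Fml.subst, term_subst_subst]
  | rel P ts => simp [Fml.subst, term_subst_subst]
  | rtc φ s t ih => simp [Fml.subst, term_subst_subst, up_subst_up, ih]
  | all φ ih => simp [Fml.subst, up_subst_up, ih]
  | ex φ ih => simp [Fml.subst, up_subst_up, ih]
  | _ => simp_all [Fml.subst]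

theorem exists_not_mem_varFinset (t : L.Term ℕ) : ∃ N, ∀ x ≥ N, x ∉ t.varFinset :=
  ⟨t.varFinset.sup id + 1, fun x hx h => by
    have := Finset.le_sup (f := id) h
    simp only [id] at this
    omega⟩

theorem Fml.exists_not_isFree (φ : Fml L) : ∃ N, ∀ x ≥ N, ¬ φ.IsFree x := by
  induction φ with
  | eq s t =>
    obtain ⟨N, h⟩ := exists_not_mem_varFinset s
    obtain ⟨K, k⟩ := exists_not_mem_varFinset t
    exact ⟨max N K, fun x hx => not_or.2 ⟨h x (le_of_max_le_left hx), k x (le_of_max_le_right hx)⟩⟩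
  | rel P ts =>
    choose N h using fun i => exists_not_mem_varFinset (ts i)
    exact ⟨Finset.univ.sup N, fun x hx ⟨i, hi⟩ =>
      h i x ((Finset.le_sup (Finset.mem_univ i)).trans hx) hi⟩
  | neg φ ih => exact ih
  | and φ ψ ih₁ ih₂ | or φ ψ ih₁ ih₂ | imp φ ψ ih₁ ih₂ =>
    obtain ⟨N, h⟩ := ih₁
    obtain ⟨K, k⟩ := ih₂
    exact ⟨max N K, fun x hx => not_or.2 ⟨h x (le_of_max_le_left hx), k x (le_of_max_le_right hx)⟩⟩
  | all φ ih | ex φ ih =>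
    obtain ⟨N, h⟩ := ih
    exact ⟨N, fun x hx => h (x + 1) (le_add_right hx)⟩
  | rtc φ s t ih =>
    obtain ⟨N, h⟩ := ih
    obtain ⟨K, k⟩ := exists_not_mem_varFinset s
    obtain ⟨J, j⟩ := exists_not_mem_varFinset t
    refine ⟨max N (max K J), fun x hx => ?_⟩
    simp only [ge_iff_le, max_le_iff] at hx
    rintro (h' | h' | h')
    · exact h (x + 2) (by omega) h'
    · exact k x hx.2.1 h'
    · exact j x hx.2.2 h'

/-! ### Proof search -/

/-- The sequent given by a list of signed formulas: those with sign `true` are on the left. -/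
noncomputable def seqOf (l : List (Bool × Fml L)) : Sequent L where
  ante := ((l.filter fun a => a.1).map Prod.snd).toFinset
  succ := ((l.filter fun a => !a.1).map Prod.snd).toFinset

theorem mem_ante_seqOf {l : List (Bool × Fml L)} {φ : Fml L} :
    φ ∈ (seqOf l).ante ↔ (true, φ) ∈ l := by
  simp [seqOf]

theorem mem_succ_seqOf {l : List (Bool × Fml L)} {φ : Fml L} :
    φ ∈ (seqOf l).succ ↔ (false, φ) ∈ l := by
  simp [seqOf]

theorem exists_fresh (l : List (Bool × Fml L)) : ∃ z, ∀ a ∈ l, ¬ a.2.IsFree z := by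
  induction l with
  | nil => exact ⟨0, by simp⟩
  | cons a l _ =>
    choose N h using fun a : Bool × Fml L => a.2.exists_not_isFree
    refine ⟨((a :: l).map N).sum, fun b hb => h b _ ?_⟩
    exact List.single_le_sum (by simp) _ (List.mem_map_of_mem hb)

/-- The signed formulas added to the premises when the signed formula is decomposed, one list for
each premise; `t` is the instantiating term (the intermediate one for `RTC` on the right) and `z`
the eigenvariable. Signed atoms are not decomposed. -/
def adds (t : L.Term ℕ) (z : ℕ) : Bool × Fml L → List (List (Bool × Fml L))
  | (true, .neg φ) => [[(false, φ)]]
  | (true, .and φ ψ) => [[(true, φ), (true, ψ)]]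
  | (true, .or φ ψ) => [[(true, φ)], [(true, ψ)]]
  | (true, .imp φ ψ) => [[(false, φ)], [(true, ψ)]]
  | (true, .all φ) => [[(true, φ.inst t)]]
  | (true, .ex φ) => [[(true, φ.inst (Term.var z))]]
  | (true, .rtc φ s r) =>
      [[(true, .eq s r)], [(true, .rtc φ s (Term.var z)), (true, φ.inst₂ (Term.var z) r)]]
  | (false, .neg φ) => [[(true, φ)]]
  | (false, .and φ ψ) => [[(false, φ)], [(false, ψ)]]
  | (false, .or φ ψ) => [[(false, φ), (false, ψ)]]
  | (false, .imp φ ψ) => [[(true, φ), (false, ψ)]]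
  | (false, .all φ) => [[(false, φ.inst (Term.var z))]]
  | (false, .ex φ) => [[(false, φ.inst t)]]
  | (false, .rtc φ s r) => [[(false, .rtc φ s t)], [(false, φ.inst₂ t r)]]
  | (_, .eq _ _) => [[]]
  | (_, .rel _ _) => [[]]

/-- The rule instance which decomposes a signed formula of the sequent `S`; the principal formula
is kept. For atoms it is the identity substitution, which does nothing. -/
noncomputable def decompose (S : Sequent L) (t : L.Term ℕ) (z : ℕ) : Bool × Fml L → Rule L
  | (true, .neg φ) => .negL S.ante S.succ φ
  | (true, .and φ ψ) => .andL S.ante S.succ φ ψ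
  | (true, .or φ ψ) => .orL S.ante S.succ φ ψ
  | (true, .imp φ ψ) => .impL S.ante S.succ φ ψ
  | (true, .all φ) => .allL S.ante S.succ φ t
  | (true, .ex φ) => .exL S.ante S.succ φ z
  | (true, .rtc φ s r) => .rtcUnfold S.ante S.succ φ s r z
  | (false, .neg φ) => .negR S.ante S.succ φ
  | (false, .and φ ψ) => .andR S.ante S.succ φ ψ
  | (false, .or φ ψ) => .orR S.ante S.succ φ ψ
  | (false, .imp φ ψ) => .impR S.ante S.succ φ ψ
  | (false, .all φ) => .allR S.ante S.succ φ z
  | (false, .ex φ) => .exR S.ante S.succ φ t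
  | (false, .rtc φ s r) => .rtcTrans S.ante S.succ φ s t r
  | (_, .eq _ _) => .subst S.ante S.succ fun k => Term.var k
  | (_, .rel _ _) => .subst S.ante S.succ fun k => Term.var k

theorem decompose_spec {l : List (Bool × Fml L)} {t : L.Term ℕ} {z : ℕ}
    (hz : ∀ a ∈ l, ¬ a.2.IsFree z) {a : Bool × Fml L} (ha : a ∈ l) :
    (decompose (seqOf l) t z a).Side ∧ ¬ (decompose (seqOf l) t z a).IsCut ∧
    (decompose (seqOf l) t z a).concl = seqOf l ∧
    (decompose (seqOf l) t z a).prems = (adds t z a).map (fun A => seqOf (l ++ A)) ∧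
    ∀ i τ, (decompose (seqOf l) t z a).Continues i τ τ := by
  have hΓ : Fresh z (seqOf l).ante := fun φ hφ => hz _ (mem_ante_seqOf.1 hφ)
  have hΔ : Fresh z (seqOf l).succ := fun φ hφ => hz _ (mem_succ_seqOf.1 hφ)
  have hza := hz a ha
  obtain ⟨b, φ⟩ := a
  refine ⟨?_, ?_, ?_, ?_, ?_⟩
  · cases b <;> cases φ <;> trivial
  · cases b <;> cases φ <;> exact id
  · cases b <;> cases φ <;>
      simp [decompose, Rule.concl, Rule.shape, mem_ante_seqOf, mem_succ_seqOf, ha, Fml.subst_var]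
  · cases b <;> cases φ <;>
      simp only [decompose, Rule.prems, Rule.shape, adds, List.map_cons, List.map_nil,
        List.cons.injEq, and_true, Sequent.ext_iff, Finset.ext_iff, Finset.mem_insert,
        mem_ante_seqOf, mem_succ_seqOf, List.mem_append, List.mem_cons, Prod.mk.injEq,
        List.not_mem_nil, or_false, true_and, false_and, reduceCtorEq] <;>
      (try refine ⟨?_, ?_⟩) <;> (try intro φ) <;> (try tauto)
  · intro i τ
    cases b <;> cases φ <;> first
      | exact Or.inr rfl
      | exact (Fml.subst_var τ).symm

section Search

variable (e : ℕ → L.Term ℕ)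

/-- The signed formula which is treated at a stage of the search. Every position in the list
occurs, together with every term, at infinitely many stages. -/
def task (x : List (Bool × Fml L) × ℕ) : Option (Bool × Fml L) :=
  x.1[x.2.unpair.1.unpair.1]?

/-- A variable which is free in no formula of the list. -/
noncomputable def eigen (l : List (Bool × Fml L)) : ℕ := (exists_fresh l).choose

/-- The rule instance applied at a state of the search, which is a list of signed formulas together
with the number of the stage. -/
noncomputable def searchRule (x : List (Bool × Fml L) × ℕ) : Rule L :=
  match task x with
  | none => .subst (seqOf x.1).ante (seqOf x.1).succ fun k => Term.var k
  | some a => decompose (seqOf x.1) (e x.2.unpair.1.unpair.2) (eigen x.1) a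

/-- The signed formulas added to the premises at a state of the search. -/
noncomputable def searchAdds (x : List (Bool × Fml L) × ℕ) : List (List (Bool × Fml L)) :=
  match task x with
  | none => [[]]
  | some a => adds (e x.2.unpair.1.unpair.2) (eigen x.1) a

/-- The state of the search at the premise number `i`. -/
noncomputable def searchNext (x : List (Bool × Fml L) × ℕ) (i : ℕ) : List (Bool × Fml L) × ℕ :=
  (x.1 ++ (searchAdds e x).getD i [], x.2 + 1)

theorem searchRule_spec (x : List (Bool × Fml L) × ℕ) :
    (searchRule e x).Side ∧ ¬ (searchRule e x).IsCut ∧ (searchRule e x).concl = seqOf x.1 ∧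
    (searchRule e x).prems = (searchAdds e x).map (fun A => seqOf (x.1 ++ A)) ∧
    ∀ i τ, (searchRule e x).Continues i τ τ := by
  unfold searchRule searchAdds
  cases h : task x with
  | none =>
    refine ⟨trivial, id, ?_, ?_, fun i τ => (Fml.subst_var τ).symm⟩
    · simp [Rule.concl, Rule.shape, Fml.subst_var]
    · simp [Rule.prems, Rule.shape]
  | some a => exact decompose_spec (exists_fresh x.1).choose_spec (List.mem_of_getElem? h)

/-- `Reach H φ s t`: the unfoldings of `(RTC φ)(s,t)` on the left, as far as they are recorded in
`H`, end with an equation after finitely many steps. -/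
inductive Reach (H : Set (Bool × Fml L)) (φ : Fml L) (s : L.Term ℕ) : L.Term ℕ → Prop
  | base {t : L.Term ℕ} : (true, Fml.eq s t) ∈ H → Reach H φ s t
  | step {z : ℕ} {t : L.Term ℕ} : (true, φ.inst₂ (Term.var z) t) ∈ H →
      Reach H φ s (Term.var z) → Reach H φ s t

/-- An unsuccessful branch of the search: it is fair, its sequents are not cut-free provable, and
no trace on it progresses infinitely often, so that all unfoldings of `RTC` formulas end. -/
structure Branch (l₀ : List (Bool × Fml L)) where
  l : ℕ → List (Bool × Fml L)
  zero : l 0 = l₀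
  mono : ∀ n, l n ⊆ l (n + 1)
  unprovable : ∀ n, ¬ CutFreeProvable (seqOf (l n))
  origin : ∀ n, ∀ a ∈ l (n + 1), a ∈ l n ∨ ∃ c ∈ l n, ∃ j z, ∃ A ∈ adds (e j) z c, a ∈ A
  saturated : ∀ n, ∀ a ∈ l n, ∀ j, ∃ z, ∃ A ∈ adds (e j) z a, ∃ m, A ⊆ l m
  reach : ∀ n φ s t, (true, Fml.rtc φ s t) ∈ l n → Reach {a | ∃ m, a ∈ l m} φ s t

theorem exists_branch {l₀ : List (Bool × Fml L)} (h : ¬ CutFreeProvable (seqOf l₀)) :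
    Nonempty (Branch e l₀) := by
  have hrun : ∃ (b : ℕ → ℕ) (x : ℕ → List (Bool × Fml L) × ℕ), x 0 = (l₀, 0) ∧
      (∀ n, ¬ CutFreeProvable (seqOf (x n).1)) ∧
      (∀ n, b n < (searchRule e (x n)).prems.length ∧ x (n + 1) = searchNext e (x n) (b n)) ∧
      ¬ HasTrace b fun n => searchRule e (x n) := by
    by_contra hno
    refine h (cutFreeProvable_of_search (searchRule e) (searchNext e) (fun x => seqOf x.1)
      (fun x _ => ?_) (l₀, 0) fun b x h₁ h₂ h₃ => ?_)
    · obtain ⟨h₁, h₂, h₃, h₄, -⟩ := searchRule_spec e x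
      refine ⟨h₁, h₂, h₃, fun i S hS => ?_⟩
      rw [h₄, List.getElem?_map] at hS
      obtain ⟨A, hA, rfl⟩ := Option.map_eq_some_iff.1 hS
      simp [searchNext, List.getD, hA]
    · by_contra h₄
      exact hno ⟨b, x, h₁, h₂, h₃, h₄⟩
  obtain ⟨b, x, hx₀, hunp, hx, hno⟩ := hrun
  have hstage : ∀ n, (x n).2 = n := fun n => by
    induction n with
    | zero => rw [hx₀]
    | succ n ih => rw [(hx n).2, searchNext, ih]
  have hadd : ∀ n, ∃ A, (searchAdds e (x n))[b n]? = some A ∧ (x (n + 1)).1 = (x n).1 ++ A := by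
    intro n
    obtain ⟨hlt, hs⟩ := hx n
    rw [(searchRule_spec e (x n)).2.2.2.1, List.length_map] at hlt
    refine ⟨_, List.getElem?_eq_getElem hlt, ?_⟩
    rw [hs]
    simp [searchNext, List.getD, hlt]
  have hmono : ∀ n, (x n).1 ⊆ (x (n + 1)).1 := fun n => by
    obtain ⟨A, -, hA⟩ := hadd n
    rw [hA]
    exact List.subset_append_left _ _
  -- positions in the list are stable, so every signed formula is treated again and again
  have hget : ∀ {q n : ℕ} {a : Bool × Fml L}, (x n).1[q]? = some a →
      ∀ m ≥ n, (x m).1[q]? = some a := by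
    intro q n a hq m hm
    induction m, hm using Nat.le_induction with
    | base => exact hq
    | succ m _ ih =>
      obtain ⟨A, -, hA⟩ := hadd m
      obtain ⟨hlt, -⟩ := List.getElem?_eq_some_iff.1 ih
      rw [hA, List.getElem?_append_left hlt, ih]
  have hfair : ∀ (n : ℕ) (a : Bool × Fml L) (j : ℕ), a ∈ (x n).1 → ∃ m ≥ n,
      task (x m) = some a ∧ (x m).2.unpair.1.unpair.2 = j := by
    intro n a j ha
    obtain ⟨q, hq⟩ := List.mem_iff_getElem?.1 ha
    refine ⟨Nat.pair (Nat.pair q j) n, Nat.right_le_pair _ _, ?_, ?_⟩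
    · simp only [task, hstage, Nat.unpair_pair]
      exact hget hq _ (Nat.right_le_pair _ _)
    · simp [hstage]
  refine ⟨⟨fun n => (x n).1, by simp [hx₀], hmono, hunp, ?_, ?_, ?_⟩⟩
  · intro n a ha
    obtain ⟨A, hA, hA'⟩ := hadd n
    rw [hA'] at ha
    refine (List.mem_append.1 ha).imp_right fun ha => ?_
    unfold searchAdds at hA
    cases htask : task (x n) with
    | none =>
      rw [htask] at hA
      have := List.mem_of_getElem? hA
      simp only [List.mem_singleton] at this
      simp [this] at ha
    | some c =>
      rw [htask] at hA
      exact ⟨c, List.mem_of_getElem? htask, _, _, A, List.mem_of_getElem? hA, ha⟩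
  · intro n a ha j
    obtain ⟨m, -, hm, hj⟩ := hfair n a j ha
    obtain ⟨A, hA, hA'⟩ := hadd m
    simp only [searchAdds, hm, hj] at hA
    refine ⟨_, A, List.mem_of_getElem? hA, m + 1, ?_⟩
    rw [hA']
    exact List.subset_append_right _ _
  · intro k φ s t hk
    by_contra hreach
    refine hno ?_
    classical
    -- the trace follows the unfoldings of `(RTC φ)(s,t)`, which never end
    let u : ℕ → L.Term ℕ := fun i => Nat.rec t (fun i r =>
      if task (x (k + i)) = some (true, .rtc φ s r) then Term.var (eigen (x (k + i)).1) else r) i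
    have hu : ∀ i, u (i + 1) = if task (x (k + i)) = some (true, .rtc φ s (u i)) then
      Term.var (eigen (x (k + i)).1) else u i := fun _ => rfl
    have hprog : ∀ i, task (x (k + i)) = some (true, .rtc φ s (u i)) →
        ¬ Reach {a | ∃ m, a ∈ (x m).1} φ s (u i) →
        b (k + i) = 1 ∧ (true, .rtc φ s (u (i + 1))) ∈ (x (k + (i + 1))).1 ∧
          ¬ Reach {a | ∃ m, a ∈ (x m).1} φ s (u (i + 1)) := by
      intro i htask hr
      rw [hu, if_pos htask]
      obtain ⟨A, hA, hA'⟩ := hadd (k + i)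
      simp only [searchAdds, htask, adds] at hA
      rcases hb : b (k + i) with _ | _ | j
      · rw [hb] at hA
        obtain rfl := Option.some.inj hA
        exact (hr (.base ⟨_, by rw [hA']; simp⟩)).elim
      · rw [hb] at hA
        obtain rfl := Option.some.inj hA
        refine ⟨rfl, ?_, fun hr' => hr (.step ⟨k + i + 1, ?_⟩ hr')⟩
        · rw [← add_assoc, hA']
          simp
        · rw [hA']
          simp
      · simp [hb] at hA
    have hinv : ∀ i, (true, .rtc φ s (u i)) ∈ (x (k + i)).1 ∧
        ¬ Reach {a | ∃ m, a ∈ (x m).1} φ s (u i) := by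
      intro i
      induction i with
      | zero => exact ⟨hk, hreach⟩
      | succ i ih =>
        by_cases htask : task (x (k + i)) = some (true, .rtc φ s (u i))
        · exact (hprog i htask ih.2).2
        · rw [hu, if_neg htask]
          exact ⟨hmono _ ih.1, ih.2⟩
    have hrule : ∀ i, task (x (k + i)) = some (true, .rtc φ s (u i)) →
        (searchRule e (x (k + i))).Progressing (b (k + i)) (.rtc φ s (u i))
          (.rtc φ s (u (i + 1))) ∧
        (searchRule e (x (k + i))).Continues (b (k + i)) (.rtc φ s (u i))
          (.rtc φ s (u (i + 1))) := by
      intro i htask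
      have hp : (searchRule e (x (k + i))).Progressing (b (k + i)) (.rtc φ s (u i))
          (.rtc φ s (u (i + 1))) := by
        rw [hu, if_pos htask]
        simp only [searchRule, htask, decompose]
        exact ⟨(hprog i htask (hinv i).2).1, rfl, rfl⟩
      refine ⟨hp, ?_⟩
      simp only [searchRule, htask, decompose] at hp ⊢
      exact Or.inl hp
    refine ⟨k, fun i => .rtc φ s (u i), fun i => ⟨⟨_, _, _, rfl⟩, ⟨_, _, _, rfl⟩, ?_, ?_, ?_⟩,
      fun m => ?_⟩
    · rw [(searchRule_spec e (x (k + i))).2.2.1, mem_ante_seqOf]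
      exact (hinv i).1
    · obtain ⟨A, hA, hA'⟩ := hadd (k + i)
      refine ⟨seqOf (x (k + i + 1)).1, ?_, mem_ante_seqOf.2 (hinv (i + 1)).1⟩
      rw [(searchRule_spec e (x (k + i))).2.2.2.1, List.getElem?_map, hA, hA']
      rfl
    · by_cases htask : task (x (k + i)) = some (true, .rtc φ s (u i))
      · exact (hrule i htask).2
      · simp only [hu, if_neg htask]
        exact (searchRule_spec e (x (k + i))).2.2.2.2 _ _
    · by_contra hlate
      have hidle : ∀ i ≥ m, task (x (k + i)) ≠ some (true, .rtc φ s (u i)) :=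
        fun i hi htask => hlate ⟨i, hi, (hrule i htask).1⟩
      have hconst : ∀ i ≥ m, u i = u m := fun i hi => by
        induction i, hi using Nat.le_induction with
        | base => rfl
        | succ i hi ih => rw [hu, if_neg (hidle i hi), ih]
      obtain ⟨n, hn, htask, -⟩ := hfair (k + m) _ 0 (hinv m).1
      obtain ⟨i, rfl⟩ := Nat.exists_eq_add_of_le ((Nat.le_add_right k m).trans hn)
      have hi : m ≤ i := by omega
      exact hidle i hi (by rw [hconst i hi]; exact htask)

end Search

/-! ### Function symbols -/

/-- The function symbols of a term. -/
def termFuncs : L.Term ℕ → Set (Σ n, L.Functions n)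
  | .var _ => ∅
  | .func f ts => insert ⟨_, f⟩ (⋃ i, termFuncs (ts i))

/-- The function symbols of a formula. -/
def Fml.funcs : Fml L → Set (Σ n, L.Functions n)
  | .eq s t => termFuncs s ∪ termFuncs t
  | .rel _ ts => ⋃ i, termFuncs (ts i)
  | .neg φ => φ.funcs
  | .and φ ψ => φ.funcs ∪ ψ.funcs
  | .or φ ψ => φ.funcs ∪ ψ.funcs
  | .imp φ ψ => φ.funcs ∪ ψ.funcs
  | .all φ => φ.funcs
  | .ex φ => φ.funcs
  | .rtc φ s t => φ.funcs ∪ (termFuncs s ∪ termFuncs t)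

theorem countable_termFuncs (t : L.Term ℕ) : (termFuncs t).Countable := by
  induction t with
  | var x => exact Set.countable_empty
  | func f ts ih => exact (Set.countable_iUnion ih).insert _

theorem Fml.countable_funcs (φ : Fml L) : φ.funcs.Countable := by
  induction φ with
  | rel P ts => exact Set.countable_iUnion fun i => countable_termFuncs (ts i)
  | _ => simp_all [Fml.funcs, countable_termFuncs]

variable {F : Set (Σ n, L.Functions n)}

theorem termFuncs_subst {t : L.Term ℕ} (ht : termFuncs t ⊆ F) {σ : ℕ → L.Term ℕ}
    (hσ : ∀ k, termFuncs (σ k) ⊆ F) : termFuncs (t.subst σ) ⊆ F := by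
  induction t with
  | var x => exact hσ x
  | func f ts ih =>
    simp only [termFuncs, Term.subst, Set.insert_subset_iff, Set.iUnion_subset_iff] at ht ⊢
    exact ⟨ht.1, fun i => ih i (ht.2 i)⟩

theorem termFuncs_up {σ : ℕ → L.Term ℕ} (hσ : ∀ k, termFuncs (σ k) ⊆ F) (k : ℕ) :
    termFuncs (up σ k) ⊆ F := by
  cases k with
  | zero => simp [up, termFuncs]
  | succ k =>
    have h : ∀ t : L.Term ℕ, termFuncs (t.relabel Nat.succ) = termFuncs t := fun t => by
      induction t with
      | var x => rfl
      | func f ts ih => simp [termFuncs, Term.relabel, ih]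
    simpa [up, h] using hσ k

theorem Fml.funcs_subst {φ : Fml L} (hφ : φ.funcs ⊆ F) {σ : ℕ → L.Term ℕ}
    (hσ : ∀ k, termFuncs (σ k) ⊆ F) : (φ.subst σ).funcs ⊆ F := by
  induction φ generalizing σ with
  | rel P ts =>
    simp only [Fml.funcs, Fml.subst, Set.iUnion_subset_iff] at hφ ⊢
    exact fun i => termFuncs_subst (hφ i) hσ
  | all φ ih => exact ih hφ (termFuncs_up hσ)
  | ex φ ih => exact ih hφ (termFuncs_up hσ)
  | rtc φ s t ih =>
    simp only [Fml.funcs, Fml.subst, Set.union_subset_iff] at hφ ⊢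
    exact ⟨ih hφ.1 (termFuncs_up (termFuncs_up hσ)), termFuncs_subst hφ.2.1 hσ,
      termFuncs_subst hφ.2.2 hσ⟩
  | _ => simp_all [Fml.funcs, Fml.subst, termFuncs_subst]

theorem Fml.funcs_inst {φ : Fml L} (hφ : φ.funcs ⊆ F) {t : L.Term ℕ} (ht : termFuncs t ⊆ F) :
    (φ.inst t).funcs ⊆ F := by
  refine funcs_subst hφ fun k => ?_
  cases k with
  | zero => exact ht
  | succ k => exact Set.empty_subset _

theorem Fml.funcs_inst₂ {φ : Fml L} (hφ : φ.funcs ⊆ F) {r t : L.Term ℕ} (hr : termFuncs r ⊆ F)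
    (ht : termFuncs t ⊆ F) : (φ.inst₂ r t).funcs ⊆ F := by
  refine funcs_subst hφ fun k => ?_
  rcases k with _ | _ | k
  · exact hr
  · exact ht
  · exact Set.empty_subset _

theorem funcs_of_mem_adds {t : L.Term ℕ} (ht : termFuncs t ⊆ F) {z : ℕ} {c a : Bool × Fml L}
    (hc : c.2.funcs ⊆ F) {A : List (Bool × Fml L)} (hA : A ∈ adds t z c) (ha : a ∈ A) :
    a.2.funcs ⊆ F := by
  have hz : termFuncs (Term.var z : L.Term ℕ) ⊆ F := Set.empty_subset _
  obtain ⟨b, φ⟩ := c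
  cases b <;> cases φ <;>
    simp only [adds, List.mem_cons, List.not_mem_nil, or_false, Fml.funcs,
      Set.union_subset_iff] at hA hc <;>
    (try rcases hA with rfl | rfl) <;>
    simp only [List.mem_cons, List.not_mem_nil, or_false] at ha <;>
    (try rcases ha with rfl | rfl) <;>
    simp_all [Fml.funcs, Fml.funcs_inst, Fml.funcs_inst₂, Set.union_subset_iff]

theorem countable_terms (hF : F.Countable) : {t : L.Term ℕ | termFuncs t ⊆ F}.Countable := by
  let L' : FirstOrder.Language.{u, 0} := ⟨fun n => {f : L.Functions n // ⟨n, f⟩ ∈ F}, fun _ => Empty⟩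
  let ι : L' →ᴸ L := ⟨fun _ f => f.1, fun _ r => r.elim⟩
  have hcount : Countable (Σ n, L'.Functions n) := by
    have := hF.to_subtype
    refine Function.Injective.countable (β := F) (f := fun p => ⟨⟨p.1, p.2.1⟩, p.2.2⟩) ?_
    rintro ⟨n, f, hf⟩ ⟨m, g, hg⟩ h
    simp only [Subtype.mk.injEq, Sigma.mk.injEq] at h
    obtain ⟨rfl, h⟩ := h
    obtain rfl := eq_of_heq h
    rfl
  refine (Set.countable_range (ι.onTerm : L'.Term ℕ → L.Term ℕ)).mono fun t ht => ?_
  induction t with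
  | var x => exact ⟨Term.var x, rfl⟩
  | func f ts ih =>
    simp only [termFuncs, Set.mem_ofPred_eq, Set.insert_subset_iff, Set.iUnion_subset_iff] at ht ih
    choose ts' hts using fun i => ih i (ht.2 i)
    refine ⟨Term.func (⟨f, ht.1⟩ : L'.Functions _) ts', ?_⟩
    simp [LHom.onTerm, hts, ι]

/-! ### Provable equality of terms -/

/-- Replacing `s` by `t` in the succedent does not affect cut-free provability in the presence of
`Γ`. In this form equality of terms is a congruence for all formula contexts at once. -/
def TermEq (Γ : Finset (Fml L)) (s t : L.Term ℕ) : Prop :=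
  ∀ Γ', Γ ⊆ Γ' → ∀ (Δ : Finset (Fml L)) (φ : Fml L),
    CutFreeProvable ⟨Γ', insert (φ.inst s) Δ⟩ ↔ CutFreeProvable ⟨Γ', insert (φ.inst t) Δ⟩

theorem TermEq.refl (Γ : Finset (Fml L)) (s : L.Term ℕ) : TermEq Γ s s := fun _ _ _ _ => Iff.rfl

theorem TermEq.symm {Γ : Finset (Fml L)} {s t : L.Term ℕ} (h : TermEq Γ s t) : TermEq Γ t s :=
  fun Γ' hΓ Δ φ => (h Γ' hΓ Δ φ).symm

theorem TermEq.trans {Γ : Finset (Fml L)} {r s t : L.Term ℕ} (h₁ : TermEq Γ r s)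
    (h₂ : TermEq Γ s t) : TermEq Γ r t :=
  fun Γ' hΓ Δ φ => (h₁ Γ' hΓ Δ φ).trans (h₂ Γ' hΓ Δ φ)

theorem TermEq.mono {Γ Γ' : Finset (Fml L)} {s t : L.Term ℕ} (h : TermEq Γ s t) (hΓ : Γ ⊆ Γ') :
    TermEq Γ' s t :=
  fun Γ'' hΓ' Δ φ => h Γ'' (hΓ.trans hΓ') Δ φ

theorem TermEq.of_mem {Γ : Finset (Fml L)} {s t : L.Term ℕ} (h : .eq s t ∈ Γ) : TermEq Γ s t := by
  intro Γ' hΓ Δ φ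
  have h' := Finset.insert_eq_of_mem (hΓ h)
  constructor <;> intro hp
  · have := CutFreeProvable.of_rule (.eqL₁ Γ' Δ φ s t) trivial id
      (by simpa [Rule.prems, Rule.shape] using hp)
    simpa [Rule.concl, Rule.shape, h'] using this
  · have := CutFreeProvable.of_rule (.eqL₂ Γ' Δ φ s t) trivial id
      (by simpa [Rule.prems, Rule.shape] using hp)
    simpa [Rule.concl, Rule.shape, h'] using this

/-- Instantiation as a substitution; `push` extends the sequence of the variables by `t`. -/
theorem Fml.inst_eq_subst (φ : Fml L) (t : L.Term ℕ) : φ.inst t = φ.subst (push t Term.var) := by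
  refine congrArg φ.subst (funext fun k => ?_)
  cases k <;> rfl

theorem relabel_subst_push (s t : L.Term ℕ) :
    (t.relabel Nat.succ).subst (push s Term.var) = t := by
  induction t with
  | var x => rfl
  | func f ts ih => simp [Term.subst, Term.relabel, ih]

theorem TermEq.subst_update {Γ Γ' Δ : Finset (Fml L)} {s t : L.Term ℕ} (h : TermEq Γ s t)
    (hΓ : Γ ⊆ Γ') (φ : Fml L) (σ : ℕ → L.Term ℕ) (k : ℕ) :
    CutFreeProvable ⟨Γ', insert (φ.subst (Function.update σ k s)) Δ⟩ ↔
      CutFreeProvable ⟨Γ', insert (φ.subst (Function.update σ k t)) Δ⟩ := by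
  have hcontext : ∀ r : L.Term ℕ, φ.subst (Function.update σ k r) =
      (φ.subst (Function.update (fun j => (σ j).relabel Nat.succ) k (Term.var 0))).inst r := by
    intro r
    rw [Fml.inst_eq_subst, Fml.subst_subst]
    refine congrArg φ.subst (funext fun j => ?_)
    by_cases hj : j = k
    · subst hj
      simp [Term.subst, push]
    · simp [Function.update_of_ne hj, relabel_subst_push]
  rw [hcontext s, hcontext t]
  exact h Γ' hΓ Δ _

theorem cutFreeProvable_subst_congr {Γ Γ' Δ : Finset (Fml L)} (hΓ : Γ ⊆ Γ') (φ : Fml L) (n : ℕ)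
    {σ τ : ℕ → L.Term ℕ} (h : ∀ i < n, TermEq Γ (σ i) (τ i)) (h' : ∀ i ≥ n, σ i = τ i) :
    CutFreeProvable ⟨Γ', insert (φ.subst σ) Δ⟩ ↔ CutFreeProvable ⟨Γ', insert (φ.subst τ) Δ⟩ := by
  induction n generalizing σ with
  | zero => rw [funext fun i => h' i (Nat.zero_le i)]
  | succ n ih =>
    have h₁ := (h n n.lt_succ_self).subst_update (Δ := Δ) hΓ φ σ n
    rw [Function.update_eq_self] at h₁
    refine h₁.trans (ih (fun i hi => ?_) fun i hi => ?_)
    · rw [Function.update_of_ne hi.ne]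
      exact h i (hi.trans n.lt_succ_self)
    · rcases hi.eq_or_lt with rfl | hi
      · simp
      · rw [Function.update_of_ne hi.ne']
        exact h' i hi

/-- The substitution which replaces the first `n` variables by given terms and renumbers the other
ones. -/
def tuple {n : ℕ} (ts : Fin n → L.Term ℕ) (k : ℕ) : L.Term ℕ :=
  if h : k < n then ts ⟨k, h⟩ else Term.var (k - n)

theorem cutFreeProvable_tuple_congr {Γ Γ' Δ : Finset (Fml L)} (hΓ : Γ ⊆ Γ') (φ : Fml L) {n : ℕ}
    {ss ts : Fin n → L.Term ℕ} (h : ∀ i, TermEq Γ (ss i) (ts i)) :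
    CutFreeProvable ⟨Γ', insert (φ.subst (tuple ss)) Δ⟩ ↔
      CutFreeProvable ⟨Γ', insert (φ.subst (tuple ts)) Δ⟩ := by
  refine cutFreeProvable_subst_congr hΓ φ n (fun i hi => ?_) fun i hi => ?_
  · simpa [tuple, hi] using h ⟨i, hi⟩
  · simp [tuple, not_lt.2 hi]

theorem TermEq.func {Γ : Finset (Fml L)} {n : ℕ} (f : L.Functions n) {ss ts : Fin n → L.Term ℕ}
    (h : ∀ i, TermEq Γ (ss i) (ts i)) : TermEq Γ (Term.func f ss) (Term.func f ts) := by
  intro Γ' hΓ Δ φ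
  have hcontext : ∀ rs : Fin n → L.Term ℕ, φ.inst (Term.func f rs) =
      (φ.subst (push (Term.func f fun i => Term.var i) fun k => Term.var (n + k))).subst
        (tuple rs) := by
    intro rs
    rw [Fml.inst_eq_subst, Fml.subst_subst]
    refine congrArg φ.subst (funext fun k => ?_)
    cases k <;> simp [push, Term.subst, tuple]
  rw [hcontext, hcontext]
  exact cutFreeProvable_tuple_congr hΓ _ h

/-- An atom on the right follows from one on the left up to equality: rewriting on the right turns it
into an axiom. -/
theorem CutFreeProvable.rel {Γ Δ : Finset (Fml L)} {n : ℕ} (P : L.Relations n)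
    {ss ts : Fin n → L.Term ℕ} (h : ∀ i, TermEq Γ (ss i) (ts i)) (hs : .rel P ss ∈ Γ)
    (ht : .rel P ts ∈ Δ) : CutFreeProvable ⟨Γ, Δ⟩ := by
  have hcontext : ∀ rs : Fin n → L.Term ℕ, Fml.rel P rs =
      (Fml.rel P fun i => Term.var i).subst (tuple rs) := by
    intro rs
    simp [Fml.subst, Term.subst, tuple]
  rw [← Finset.insert_eq_of_mem ht, hcontext,
    ← cutFreeProvable_tuple_congr (Finset.Subset.refl Γ) _ h, ← hcontext]
  exact .of_mem hs (Finset.mem_insert_self _ _)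

theorem CutFreeProvable.eq {Γ Δ : Finset (Fml L)} {s t : L.Term ℕ} (h : TermEq Γ s t)
    (ht : .eq s t ∈ Δ) : CutFreeProvable ⟨Γ, Δ⟩ := by
  have hcontext : ∀ r : L.Term ℕ, Fml.eq s r =
      (Fml.eq (s.relabel Nat.succ) (Term.var 0)).inst r := by
    intro r
    rw [Fml.inst_eq_subst, Fml.subst, relabel_subst_push]
    rfl
  rw [← Finset.insert_eq_of_mem ht, hcontext, ← h Γ (Finset.Subset.refl Γ), ← hcontext]
  exact (CutFreeProvable.of_rule (.eqR s) trivial id (by simp [Rule.prems, Rule.shape])).weaken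
    (Finset.empty_subset _) (by simp)

theorem CutFreeProvable.rtc {Γ Δ : Finset (Fml L)} {φ : Fml L} {s t : L.Term ℕ}
    (h : TermEq Γ s t) (ht : .rtc φ s t ∈ Δ) : CutFreeProvable ⟨Γ, Δ⟩ := by
  have hcontext : ∀ r : L.Term ℕ, Fml.rtc φ s r = (Fml.rtc
      (φ.subst (up (up fun k => Term.var (k + 1)))) (s.relabel Nat.succ) (Term.var 0)).inst r := by
    intro r
    rw [Fml.inst_eq_subst, Fml.subst, relabel_subst_push, Fml.subst_subst, up_subst_up,
      up_subst_up]
    have : (fun k => ((Term.var (k + 1) : L.Term ℕ)).subst (push r Term.var)) =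
      fun k => Term.var k := rfl
    rw [this, up_var, up_var, Fml.subst_var]
    rfl
  rw [← Finset.insert_eq_of_mem ht, hcontext, ← h Γ (Finset.Subset.refl Γ), ← hcontext]
  exact CutFreeProvable.of_rule (.rtcRefl Γ Δ φ s) trivial id (by simp [Rule.prems, Rule.shape])

/-! ### The countermodel -/

/-- The number of connectives of a formula; it does not depend on the terms in it. -/
def Fml.size : Fml L → ℕ
  | .eq _ _ => 0
  | .rel _ _ => 0
  | .neg φ => φ.size + 1
  | .and φ ψ => φ.size + ψ.size + 1
  | .or φ ψ => φ.size + ψ.size + 1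
  | .imp φ ψ => φ.size + ψ.size + 1
  | .all φ => φ.size + 1
  | .ex φ => φ.size + 1
  | .rtc φ _ _ => φ.size + 1

theorem Fml.size_subst (φ : Fml L) (σ : ℕ → L.Term ℕ) : (φ.subst σ).size = φ.size := by
  induction φ generalizing σ <;> simp_all [Fml.subst, Fml.size]

namespace Branch

variable {e : ℕ → L.Term ℕ} {l₀ : List (Bool × Fml L)} (B : Branch e l₀)

theorem subset {m n : ℕ} (h : m ≤ n) : B.l m ⊆ B.l n := by
  induction n, h using Nat.le_induction with
  | base => exact List.Subset.refl _
  | succ n _ ih => exact List.Subset.trans ih (B.mono n)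

theorem ante_subset {m n : ℕ} (h : m ≤ n) : (seqOf (B.l m)).ante ⊆ (seqOf (B.l n)).ante :=
  fun _ hφ => mem_ante_seqOf.2 (B.subset h (mem_ante_seqOf.1 hφ))

/-- Equality of terms over the function symbols `F`, provable from the left-hand side of some
sequent of the branch. -/
def setoid (F : Set (Σ n, L.Functions n)) : Setoid {t : L.Term ℕ // termFuncs t ⊆ F} where
  r s t := ∃ n, TermEq (seqOf (B.l n)).ante s.1 t.1
  iseqv :=
    { refl := fun _ => ⟨0, .refl _ _⟩
      symm := fun ⟨n, h⟩ => ⟨n, h.symm⟩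
      trans := fun ⟨n, h⟩ ⟨m, k⟩ => ⟨max n m, (h.mono (B.ante_subset (le_max_left n m))).trans
        (k.mono (B.ante_subset (le_max_right n m)))⟩ }

theorem exists_termEq {F : Set (Σ n, L.Functions n)} {n : ℕ}
    {ss ts : Fin n → {t : L.Term ℕ // termFuncs t ⊆ F}}
    (h : ∀ i, Quotient.mk (B.setoid F) (ss i) = Quotient.mk (B.setoid F) (ts i)) :
    ∃ N, ∀ m ≥ N, ∀ i, TermEq (seqOf (B.l m)).ante (ss i).1 (ts i).1 := by
  choose N hN using fun i => Quotient.exact (h i)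
  exact ⟨Finset.univ.sup N, fun m hm i =>
    (hN i).mono (B.ante_subset ((Finset.le_sup (Finset.mem_univ i)).trans hm))⟩

/-- The domain of the countermodel: terms over the function symbols `F` up to provable
equality. -/
def Model (F : Set (Σ n, L.Functions n)) : Type u := Quotient (B.setoid F)

variable (F) in
/-- The class of a term in the countermodel. -/
def cls (t : L.Term ℕ) (ht : termFuncs t ⊆ F) : B.Model F := Quotient.mk (B.setoid F) ⟨t, ht⟩

theorem termFuncs_func {n : ℕ} {f : L.Functions n} (hf : ⟨n, f⟩ ∈ F)
    (ts : Fin n → {t : L.Term ℕ // termFuncs t ⊆ F}) :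
    termFuncs (Term.func f fun i => (ts i).1) ⊆ F :=
  Set.insert_subset hf (Set.iUnion_subset fun i => (ts i).2)

/-- Functions act on classes of terms through representatives, with a dummy value for the function
symbols outside of `F`; a relation holds as required by the left-hand sides of the branch. -/
noncomputable instance : L.Structure (B.Model F) where
  funMap {n} f xs := by
    classical
    exact if hf : ⟨n, f⟩ ∈ F then
      B.cls F (Term.func f fun i => (Quotient.out (xs i)).1) (termFuncs_func hf _)
    else B.cls F (Term.var 0) (Set.empty_subset _)
  RelMap {n} P xs := ∃ ts : Fin n → {t : L.Term ℕ // termFuncs t ⊆ F},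
    (∀ i, B.cls F (ts i).1 (ts i).2 = xs i) ∧ ∃ m, (true, Fml.rel P fun i => (ts i).1) ∈ B.l m

variable (F) in
/-- The valuation of the countermodel: every variable denotes its own class. -/
def val (k : ℕ) : B.Model F := B.cls F (Term.var k) (Set.empty_subset _)

theorem realize_val {t : L.Term ℕ} (ht : termFuncs t ⊆ F) : t.realize (B.val F) = B.cls F t ht := by
  induction t with
  | var x => rfl
  | @func n f ts ih =>
    have hf : ⟨n, f⟩ ∈ F := ht (Set.mem_insert _ _)
    have hts : ∀ i, termFuncs (ts i) ⊆ F := fun i =>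
      ((Set.subset_iUnion (fun i => termFuncs (ts i)) i).trans (Set.subset_insert _ _)).trans ht
    rw [Term.realize, funext fun i => ih i (hts i)]
    refine (dif_pos hf).trans (Quotient.sound ?_)
    obtain ⟨N, hN⟩ := B.exists_termEq
      (ss := fun i => Quotient.out (B.cls F (ts i) (hts i))) (ts := fun i => ⟨ts i, hts i⟩)
      fun i => Quotient.out_eq _
    exact ⟨N, .func f (hN N le_rfl)⟩

theorem eq_val {s t : L.Term ℕ} {n : ℕ} (h : (true, .eq s t) ∈ B.l n) (hs : termFuncs s ⊆ F)
    (ht : termFuncs t ⊆ F) : B.cls F s hs = B.cls F t ht :=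
  Quotient.sound ⟨n, .of_mem (mem_ante_seqOf.2 h)⟩

theorem funcs_subset (he : ∀ j, termFuncs (e j) ⊆ F) (hl₀ : ∀ a ∈ l₀, a.2.funcs ⊆ F) (n : ℕ) :
    ∀ a ∈ B.l n, a.2.funcs ⊆ F := by
  induction n with
  | zero => rwa [B.zero]
  | succ n ih =>
    intro a ha
    rcases B.origin n a ha with ha | ⟨c, hc, j, z, A, hA, ha⟩
    · exact ih a ha
    · exact funcs_of_mem_adds (he j) (ih c hc) hA ha

/-- The formulas on the left of the branch are true in the countermodel, those on the right are
false. -/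
theorem truth (he : Set.range e = {t | termFuncs t ⊆ F}) (hl₀ : ∀ a ∈ l₀, a.2.funcs ⊆ F) (k : ℕ) :
    ∀ φ : Fml L, φ.size = k →
      ((∃ n, (true, φ) ∈ B.l n) → φ.Holds (B.val F)) ∧
      ((∃ n, (false, φ) ∈ B.l n) → ¬ φ.Holds (B.val F)) := by
  have hej : ∀ j, termFuncs (e j) ⊆ F := fun j => he.le ⟨j, rfl⟩
  have hF := fun n => B.funcs_subset hej hl₀ n
  have hsurj : ∀ x : B.Model F, ∃ j, x = (e j).realize (B.val F) := fun x => by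
    obtain ⟨⟨t, ht⟩, rfl⟩ := Quotient.exists_rep x
    obtain ⟨j, rfl⟩ := he.ge ht
    exact ⟨j, (B.realize_val ht).symm⟩
  induction k using Nat.strong_induction_on with
  | _ k ih =>
    have ihT : ∀ (φ : Fml L) (n : ℕ), φ.size < k → (true, φ) ∈ B.l n → φ.Holds (B.val F) :=
      fun φ n hk h => (ih _ hk φ rfl).1 ⟨n, h⟩
    have ihF : ∀ (φ : Fml L) (n : ℕ), φ.size < k → (false, φ) ∈ B.l n → ¬ φ.Holds (B.val F) :=
      fun φ n hk h => (ih _ hk φ rfl).2 ⟨n, h⟩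
    intro φ hk
    cases φ with
    | eq s t =>
      refine ⟨fun ⟨n, h⟩ => ?_, fun ⟨n, h⟩ heq => ?_⟩ <;>
        obtain ⟨hs, ht⟩ := Set.union_subset_iff.1 (hF n _ h)
      · simpa only [Fml.Holds, B.realize_val hs, B.realize_val ht] using B.eq_val h hs ht
      · rw [Fml.Holds, B.realize_val hs, B.realize_val ht] at heq
        obtain ⟨m, hm⟩ := Quotient.exact heq
        exact B.unprovable (max n m) (.eq (hm.mono (B.ante_subset (le_max_right n m)))
          (mem_succ_seqOf.2 (B.subset (le_max_left n m) h)))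
    | rel P ts =>
      refine ⟨fun ⟨n, h⟩ => ?_, fun ⟨n, h⟩ hrel => ?_⟩ <;>
        have hts := Set.iUnion_subset_iff.1 (hF n _ h)
      · exact ⟨fun i => ⟨ts i, hts i⟩, fun i => (B.realize_val (hts i)).symm, n, h⟩
      · obtain ⟨ss, hss, m, hm⟩ := hrel
        obtain ⟨N, hN⟩ := B.exists_termEq (ss := ss) (ts := fun i => ⟨ts i, hts i⟩)
          fun i => (hss i).trans (B.realize_val (hts i))
        let J := max N (max n m)
        exact B.unprovable J (.rel P (hN J (le_max_left _ _))
          (mem_ante_seqOf.2 (B.subset ((le_max_right n m).trans (le_max_right _ _)) hm))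
          (mem_succ_seqOf.2 (B.subset ((le_max_left n m).trans (le_max_right _ _)) h)))
    | neg φ =>
      simp only [Fml.size] at hk
      refine ⟨fun ⟨n, h⟩ => ?_, fun ⟨n, h⟩ => ?_⟩ <;>
        obtain ⟨z, A, hA, m, hm⟩ := B.saturated n _ h 0 <;>
        simp only [adds, List.mem_cons, List.not_mem_nil, or_false] at hA <;> subst hA
      · exact ihF φ m (by omega) (hm (by simp))
      · exact not_not.2 (ihT φ m (by omega) (hm (by simp)))
    | and φ ψ =>
      simp only [Fml.size] at hk
      refine ⟨fun ⟨n, h⟩ => ?_, fun ⟨n, h⟩ => ?_⟩ <;>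
        obtain ⟨z, A, hA, m, hm⟩ := B.saturated n _ h 0 <;>
        simp only [adds, List.mem_cons, List.not_mem_nil, or_false] at hA
      · subst hA
        exact ⟨ihT φ m (by omega) (hm (by simp)), ihT ψ m (by omega) (hm (by simp))⟩
      · rcases hA with rfl | rfl
        · exact fun h' => ihF φ m (by omega) (hm (by simp)) h'.1
        · exact fun h' => ihF ψ m (by omega) (hm (by simp)) h'.2
    | or φ ψ =>
      simp only [Fml.size] at hk
      refine ⟨fun ⟨n, h⟩ => ?_, fun ⟨n, h⟩ => ?_⟩ <;>
        obtain ⟨z, A, hA, m, hm⟩ := B.saturated n _ h 0 <;>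
        simp only [adds, List.mem_cons, List.not_mem_nil, or_false] at hA
      · rcases hA with rfl | rfl
        · exact Or.inl (ihT φ m (by omega) (hm (by simp)))
        · exact Or.inr (ihT ψ m (by omega) (hm (by simp)))
      · subst hA
        exact not_or.2 ⟨ihF φ m (by omega) (hm (by simp)), ihF ψ m (by omega) (hm (by simp))⟩
    | imp φ ψ =>
      simp only [Fml.size] at hk
      refine ⟨fun ⟨n, h⟩ => ?_, fun ⟨n, h⟩ => ?_⟩ <;>
        obtain ⟨z, A, hA, m, hm⟩ := B.saturated n _ h 0 <;>
        simp only [adds, List.mem_cons, List.not_mem_nil, or_false] at hA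
      · rcases hA with rfl | rfl
        · exact fun h' => (ihF φ m (by omega) (hm (by simp)) h').elim
        · exact fun _ => ihT ψ m (by omega) (hm (by simp))
      · subst hA
        exact fun h' => ihF ψ m (by omega) (hm (by simp)) (h' (ihT φ m (by omega) (hm (by simp))))
    | all φ =>
      have hk' : ∀ t, (φ.inst t).size < k := fun t => by
        rw [Fml.inst, Fml.size_subst, ← hk]
        exact Nat.lt_succ_self _
      refine ⟨fun ⟨n, h⟩ x => ?_, fun ⟨n, h⟩ h' => ?_⟩
      · obtain ⟨j, rfl⟩ := hsurj x
        obtain ⟨z, A, hA, m, hm⟩ := B.saturated n _ h j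
        simp only [adds, List.mem_cons, List.not_mem_nil, or_false] at hA
        subst hA
        exact (holds_inst _ _ _).1 (ihT _ m (hk' _) (hm (by simp)))
      · obtain ⟨z, A, hA, m, hm⟩ := B.saturated n _ h 0
        simp only [adds, List.mem_cons, List.not_mem_nil, or_false] at hA
        subst hA
        exact ihF _ m (hk' (Term.var z)) (hm (by simp)) ((holds_inst _ _ _).2 (h' _))
    | ex φ =>
      have hk' : ∀ t, (φ.inst t).size < k := fun t => by
        rw [Fml.inst, Fml.size_subst, ← hk]
        exact Nat.lt_succ_self _
      refine ⟨fun ⟨n, h⟩ => ?_, fun ⟨n, h⟩ ⟨x, hx⟩ => ?_⟩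
      · obtain ⟨z, A, hA, m, hm⟩ := B.saturated n _ h 0
        simp only [adds, List.mem_cons, List.not_mem_nil, or_false] at hA
        subst hA
        exact ⟨_, (holds_inst _ _ _).1 (ihT _ m (hk' (Term.var z)) (hm (by simp)))⟩
      · obtain ⟨j, rfl⟩ := hsurj x
        obtain ⟨z, A, hA, m, hm⟩ := B.saturated n _ h j
        simp only [adds, List.mem_cons, List.not_mem_nil, or_false] at hA
        subst hA
        exact ihF _ m (hk' _) (hm (by simp)) ((holds_inst _ _ _).2 hx)
    | rtc φ s t =>
      have hk' : ∀ r r', (φ.inst₂ r r').size < k := fun r r' => by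
        rw [Fml.inst₂, Fml.size_subst, ← hk]
        exact Nat.lt_succ_self _
      clear hk
      refine ⟨?_, ?_⟩
      · rintro ⟨n, h⟩
        have hreach := B.reach n φ s t h
        clear h
        induction hreach with
        | base h =>
          obtain ⟨m, hm⟩ := h
          obtain ⟨hs, ht⟩ := Set.union_subset_iff.1 (hF m _ hm)
          refine ⟨0, ?_⟩
          simpa only [Steps, B.realize_val hs, B.realize_val ht] using B.eq_val hm hs ht
        | step h _ ih' =>
          obtain ⟨m, hm⟩ := h
          obtain ⟨i, hi⟩ := ih'
          exact ⟨i + 1, _, hi, (holds_inst₂ _ _ _ _).1 (ihT _ m (hk' _ _) hm)⟩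
      · rintro ⟨n, h⟩ ⟨i, hi⟩
        -- induction on the length of the chain which would make the formula true
        induction i generalizing t n with
        | zero =>
          obtain ⟨hs, ht⟩ := Set.union_subset_iff.1 (Set.union_subset_iff.1 (hF n _ h)).2
          rw [Steps, B.realize_val hs, B.realize_val ht] at hi
          obtain ⟨m, hm⟩ := Quotient.exact hi
          exact B.unprovable (max n m) (.rtc (hm.mono (B.ante_subset (le_max_right n m)))
            (mem_succ_seqOf.2 (B.subset (le_max_left n m) h)))
        | succ i ih' =>
          obtain ⟨x, hx, hxt⟩ := hi
          obtain ⟨j, rfl⟩ := hsurj x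
          obtain ⟨z, A, hA, m, hm⟩ := B.saturated n _ h j
          simp only [adds, List.mem_cons, List.not_mem_nil, or_false] at hA
          rcases hA with rfl | rfl
          · exact ih' (e j) m (hm (by simp)) hx
          · exact ihF _ m (hk' _ _) (hm (by simp)) ((holds_inst₂ _ _ _ _).2 hxt)

end Branch

/-! ### Completeness -/

theorem exists_seqOf_eq (S : Sequent L) : ∃ l, seqOf l = S := by
  refine ⟨S.ante.toList.map (Prod.mk true) ++ S.succ.toList.map (Prod.mk false), ?_⟩
  ext φ
  · simp [mem_ante_seqOf]
  · simp [mem_succ_seqOf]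

/-- Valid sequents have cut-free proofs. It is enough to consider structures in the universe of the
function symbols. -/
theorem cutFreeProvable_of_valid {S : Sequent L}
    (h : ∀ (M : Type u) [L.Structure M] (v : ℕ → M), ¬ Falsifies v S) : CutFreeProvable S := by
  by_contra hS
  obtain ⟨l, rfl⟩ := exists_seqOf_eq S
  -- only countably many function symbols matter, hence only countably many instantiating terms
  let F : Set (Σ n, L.Functions n) := ⋃ a ∈ {a | a ∈ l}, a.2.funcs
  have hF : F.Countable := (List.finite_toSet l).countable.biUnion fun a _ => a.2.countable_funcs
  have hl : ∀ a ∈ l, a.2.funcs ⊆ F := fun a ha => 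
    Set.subset_biUnion_of_mem (s := {a | a ∈ l}) (u := fun a : Bool × Fml L => a.2.funcs) ha
  obtain ⟨e, he⟩ := (countable_terms hF).exists_eq_range ⟨Term.var 0, Set.empty_subset _⟩
  obtain ⟨B⟩ := exists_branch e hS
  have htruth := fun φ => B.truth he.symm hl _ φ rfl
  refine h (B.Model F) (B.val F)
    ⟨fun φ hφ => (htruth φ).1 ⟨0, ?_⟩, fun φ hφ => (htruth φ).2 ⟨0, ?_⟩⟩
  · rw [B.zero]
    exact mem_ante_seqOf.1 hφ
  · rw [B.zero]
    exact mem_succ_seqOf.1 hφ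

theorem CutFreeProvable.provable {S : Sequent L} (h : CutFreeProvable S) : Provable S := by
  obtain ⟨P, hP, -, hS⟩ := h
  exact ⟨P, hP, hS⟩

end RTC

theorem mainTheorem3 (L : FirstOrder.Language.{u, v}) :
    (∀ S : RTC.Sequent L, RTC.Provable S → RTC.CutFreeProvable S) ∧
    (∀ (Γ Δ Γ' Δ' : Finset (RTC.Fml L)) (φ : RTC.Fml L),
      RTC.CutFreeProvable ⟨Γ, insert φ Δ⟩ → RTC.CutFreeProvable ⟨insert φ Γ', Δ'⟩ →
        RTC.CutFreeProvable ⟨Γ ∪ Γ', Δ ∪ Δ'⟩) := by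
  refine ⟨fun S hS => RTC.cutFreeProvable_of_valid fun M _ v => hS.not_falsifies v,
    fun Γ Δ Γ' Δ' φ h₁ h₂ => RTC.cutFreeProvable_of_valid fun M _ v hv => ?_⟩
  by_cases hφ : φ.Holds v
  · exact h₂.provable.not_falsifies v (RTC.falsifies_insert_ante.2 ⟨hφ,
      fun ψ hψ => hv.1 ψ (Finset.mem_union_right _ hψ),
      fun ψ hψ => hv.2 ψ (Finset.mem_union_right _ hψ)⟩)
  · exact h₁.provable.not_falsifies v (RTC.falsifies_insert_succ.2 ⟨hφ,
      fun ψ hψ => hv.1 ψ (Finset.mem_union_left _ hψ),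
      fun ψ hψ => hv.2 ψ (Finset.mem_union_left _ hψ)⟩)
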